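/- Let $M\in\mathbb N$, let $X_1,\dots,X_M\in\mathbb R^3$ be distinct points and let $Z_1,\dots,Z_M>0$. Let $\mathcal P^-$ be the set of Borel measures $\rho$ on $\mathbb R^3$ with $\rho(\mathbb R^3)\le 1$, equipped with the weak* topology (the coarsest topology for which $\rho\mapsto\int f\,d\rho$ is continuous for every $f\in C_0(\mathbb R^3)$). Let $\mathcal H\subset\mathcal P^-$ be the set of probability measures that are absolutely continuous with respect to Lebesgue measure and whose density, again denoted $\rho$, satisfies $\sqrt\rho\in H^1(\mathbb R^3)$. For $\varepsilon>0$ define $G^0_\varepsilon:\mathcal P^-\to\mathbb R\cup\{+\infty\}$ by $$G^0_\varepsilon(\rho)=\varepsilon^2\int_{\mathbb R^3}|\nabla\sqrt\rho|^2\,dx-\varepsilon\int_{\mathbb R^3}\sum_{k=1}^M\frac{Z_k}{|x-X_k|}\,\rho(x)\,dx\quad\text{if }\rho\in\mathcal H,\qquad G^0_\varepsilon(\rho)=+\infty\quad\text{otherwise.}$$ Then the $\Gamma$-limit $G^0$ of $G^0_\varepsilon$ as $\varepsilon\to0^+$ exists on $\mathcal P^-$ and $$G^0(\rho)=-\frac14\sum_{k=1}^M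 Z_k^2\,\rho(\{X_k\})\qquad\text{for every }\rho\in\mathcal P^-.$$ That is, for every $\rho\in\mathcal P^-$ the $\Gamma$-lower limit $\sup_{U}\liminf_{\varepsilon\to0^+}\inf_{\sigma\in U}G^0_\varepsilon(\sigma)$ and the $\Gamma$-upper limit $\sup_{U}\limsup_{\varepsilon\to0^+}\inf_{\sigma\in U}G^0_\varepsilon(\sigma)$, where $U$ runs over the neighbourhoods of $\rho$, are both equal to $-\frac14\sum_{k}Z_k^2\,\rho(\{X_k\})$. -/

import Mathlib

open MeasureTheory Filter Topology
open scoped ENNReal ContDiff ZeroAtInfty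

noncomputable section

namespace DensityFunctional

/-- The space `ℝ³` with its Euclidean norm and Lebesgue measure. -/
abbrev R3 : Type := EuclideanSpace ℝ (Fin 3)

/-! ### Subprobabilities with the weak* topology -/

/-- Borel measures on `ℝ³` of total mass at most one. -/
def SubProb : Type := {μ : Measure R3 // μ Set.univ ≤ 1}

/-- The underlying measure of a subprobability. -/
def SubProb.toMeasure (ρ : SubProb) : Measure R3 := ρ.1

/-- The weak* topology: the coarsest one for which `ρ ↦ ∫ f dρ` is continuous for every continuous
`f` on `ℝ³` vanishing at infinity. -/
instance : TopologicalSpace SubProb :=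
  TopologicalSpace.induced (fun (ρ : SubProb) (f : C₀(R3, ℝ)) => ∫ x, f x ∂ρ.toMeasure) inferInstance

/-! ### Γ-convergence -/

/-- The Γ-lower limit of the family `F` along the filter `l`. -/
def gammaLiminf {ι α : Type*} [TopologicalSpace α] (l : Filter ι) (F : ι → α → EReal) (x : α) :
    EReal :=
  ⨆ U ∈ 𝓝 x, liminf (fun i => ⨅ y ∈ U, F i y) l

/-- The Γ-upper limit of the family `F` along the filter `l`. -/
def gammaLimsup {ι α : Type*} [TopologicalSpace α] (l : Filter ι) (F : ι → α → EReal) (x : α) :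
    EReal :=
  ⨆ U ∈ 𝓝 x, limsup (fun i => ⨅ y ∈ U, F i y) l

/-- The Γ-limit of the family `F` along `l` exists and is `G`. -/
def GammaConverges {ι α : Type*} [TopologicalSpace α] (l : Filter ι) (F : ι → α → EReal)
    (G : α → EReal) : Prop :=
  ∀ x, gammaLiminf l F x = G x ∧ gammaLimsup l F x = G x

/-! ### The energy functionals -/

/-- `g` is the weak gradient of `u` on `ℝ³`. -/
def IsWeakGradient (u : R3 → ℝ) (g : R3 → R3) : Prop :=
  LocallyIntegrable u volume ∧ LocallyIntegrable g volume ∧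
    ∀ φ : R3 → ℝ, ContDiff ℝ ∞ φ → HasCompactSupport φ →
      ∫ x, u x • gradient φ x = - ∫ x, φ x • g x

/-- Membership in the Sobolev space `H¹(ℝ³)`. -/
def MemH1 (u : R3 → ℝ) : Prop :=
  MemLp u 2 volume ∧ ∃ g : R3 → R3, MemLp g 2 volume ∧ IsWeakGradient u g

/-- The square root of the Lebesgue density of `ρ`. -/
def sqrtDensity (ρ : Measure R3) (x : R3) : ℝ :=
  √((ρ.rnDeriv volume x).toReal)

/-- The probabilities on `ℝ³` that have a density whose square root is in `H¹(ℝ³)`. -/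
def admissible : Set SubProb :=
  {ρ | ρ.toMeasure Set.univ = 1 ∧ ρ.toMeasure ≪ volume ∧ MemH1 (sqrtDensity ρ.toMeasure)}

/-- The kinetic energy `∫ |∇√ρ|² dx`. The weak gradient is unique up to null sets, so on admissible
densities the infimum runs over a single value. -/
def kinetic (ρ : Measure R3) : ℝ≥0∞ :=
  ⨅ (g : R3 → R3) (_ : IsWeakGradient (sqrtDensity ρ) g), ∫⁻ x, ‖g x‖ₑ ^ 2

/-- The potential energy `∫ V dρ` with `V(x) = ∑ₖ Zₖ / |x - Xₖ|`. -/
def potential {M : ℕ} (Z : Fin M → ℝ) (X : Fin M → R3) (ρ : Measure R3) : ℝ≥0∞ :=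
  ∫⁻ x, ∑ k, ENNReal.ofReal (Z k) / ‖x - X k‖ₑ ∂ρ

open Classical in
/-- The non-interacting functional `ε² T(ρ) - ε U(ρ)`, with value `+∞` outside its domain. -/
def energy {M : ℕ} (Z : Fin M → ℝ) (X : Fin M → R3) (ε : ℝ) (ρ : SubProb) : EReal :=
  if ρ ∈ admissible then
    ((ENNReal.ofReal (ε ^ 2) * kinetic ρ.toMeasure : ℝ≥0∞) : EReal) -
      ((ENNReal.ofReal ε * potential Z X ρ.toMeasure : ℝ≥0∞) : EReal)
  else ⊤

/-- The functional `-¼ ∑ₖ Zₖ² ρ({Xₖ})`. -/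
def limitEnergy {M : ℕ} (Z : Fin M → ℝ) (X : Fin M → R3) (ρ : SubProb) : EReal :=
  ((-(1 / 4) * ∑ k, Z k ^ 2 * (ρ.toMeasure {X k}).toReal : ℝ) : EReal)

end DensityFunctional

end

noncomputable section

namespace DensityFunctional

open scoped RealInnerProductSpace

/-! ### Weak gradients and the product rule -/

/-! At each nucleus this is the hydrogen ground-state problem: a unit mass at scale `1 / a` has
energy about `ε² a² - ε Z a`, least at `a = Z / (2 ε)` with value `-Z² / 4`. As `ε → 0` this scale
shrinks to a point, so only atoms of the limit at the nuclei gain energy.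

Lower bound. With `u = √σ` and weak gradient `g`, expand `|ε g + (Z/2) u (x - X)/|x - X||² ≥ 0`.
Since the unit radial field has divergence `2/|x - X|`, integrating the cross term by parts produces
exactly the Coulomb term, and the price is `Z²/4` times the mass. `IsWeakGradient.coulomb_local`
carries this out behind a cutoff `χ`, with an error of order `ε`. In `le_energy` the cutoffs have
disjoint supports, so each part of the kinetic energy is spent once, and the potential away from the
nuclei costs another term of order `ε`. What remains is `-∑ Z²/4 ∫ χ² dσ`, which is weak* continuous
in `σ`; shrinking the cutoffs recovers the atoms. The integration by parts needs `∇(u²) = 2 u g` for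
weak gradients (`IsWeakGradient.integral_sq_mul_fderiv`).

Upper bound. Each atom at a nucleus is replaced by a smoothed `exp (-2 a |x - X|)` with `a = Z / (2
ε)`. The remaining mass up to 1, including what has escaped to infinity, is approximated by finitely
many points (`exists_discrete_approximation`) smeared at a scale independent of `ε`, at kinetic cost
`O(ε²)`. Superposition does not increase the weighted kinetic bound
(`norm_gradient_sqrt_mixture_sq_le`), and extra attraction only lowers the energy. -/

theorem IsWeakGradient.integral_mul_fderiv {u : R3 → ℝ} {g : R3 → R3} (h : IsWeakGradient u g)
    {φ : R3 → ℝ} (hφ : ContDiff ℝ ∞ φ) (hc : HasCompactSupport φ) (v : R3) :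
    ∫ x, u x * fderiv ℝ φ x v = -∫ x, φ x * ⟪v, g x⟫ := by
  obtain ⟨hu, hg, hw⟩ := h
  have hcont : Continuous (gradient φ) :=
    (InnerProductSpace.toDual ℝ R3).symm.continuous.comp (hφ.continuous_fderiv (by simp))
  have hsupp : HasCompactSupport (gradient φ) :=
    (hc.fderiv ℝ).comp_left (g := (InnerProductSpace.toDual ℝ R3).symm) (map_zero _)
  have h1 := integral_inner (𝕜 := ℝ) (hu.integrable_smul_right_of_hasCompactSupport hcont hsupp) v
  have h2 := integral_inner (𝕜 := ℝ) (hg.integrable_smul_left_of_hasCompactSupport hφ.continuous hc) v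
  rw [hw φ hφ hc, inner_neg_right, ← h2] at h1
  simpa [real_inner_smul_right, inner_gradient_right] using h1

/-- Translations act continuously on `L²`, and the correlation is the inner product of `a` with a
translate of `b`. -/
theorem continuous_correlation {a b : R3 → ℝ} (ha : MemLp a 2 volume) (hb : MemLp b 2 volume) :
    Continuous fun t : R3 => ∫ x, a x * b (x + t) := by
  have : Fact ((2 : ℝ≥0∞) ≠ ⊤) := ⟨ENNReal.ofNat_ne_top⟩
  have h : Continuous fun t : R3 => ⟪DomAddAct.mk t +ᵥ hb.toLp b, ha.toLp a⟫ := by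
    refine Continuous.inner ?_ continuous_const
    exact (DomAddAct.continuous_mk (M := R3)).vadd continuous_const
  convert h using 2 with t
  rw [DomAddAct.mk_vadd_toLp, L2.inner_def]
  refine integral_congr_ae ?_
  filter_upwards [ha.coeFn_toLp,
    (hb.comp_measurePreserving <| measurePreserving_vadd t volume).coeFn_toLp] with x h1 h2
  simp only [Function.comp_def] at h2
  rw [h1, h2]
  simp [add_comm]

/-- The product of `a` and shifted `b` is dominated by the sum of their squares; each square times
`φ` is integrable by Fubini, after a shear for `b`. -/
theorem integrable_shift {a b φ : R3 → ℝ} (ha : MemLp a 2 volume) (hb : MemLp b 2 volume)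
    (hφ : Integrable φ volume) :
    Integrable (fun z : R3 × R3 => a z.1 * b (z.1 + z.2) * φ z.2) (volume.prod volume) := by
  have hmp := measurePreserving_add_prod (volume : Measure R3) (volume : Measure R3)
  have h1 : Integrable (fun z : R3 × R3 => a z.1 ^ 2 * φ z.2) (volume.prod volume) :=
    ha.integrable_sq.mul_prod hφ
  have h2 : Integrable (fun z : R3 × R3 => b (z.1 + z.2) ^ 2 * φ z.2) (volume.prod volume) :=
    hmp.integrable_comp_of_integrable (hb.integrable_sq.mul_prod hφ)
  have hbm : AEStronglyMeasurable (fun z : R3 × R3 => b (z.1 + z.2)) (volume.prod volume) :=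
    (hb.aestronglyMeasurable.comp_fst (ν := (volume : Measure R3))).comp_measurePreserving hmp
  refine (h1.norm.add h2.norm).mono'
    ((ha.aestronglyMeasurable.comp_fst.mul hbm).mul hφ.aestronglyMeasurable.comp_snd) ?_
  refine Eventually.of_forall fun z => ?_
  simp only [Pi.add_apply, norm_mul, norm_pow, ← add_mul]
  gcongr
  nlinarith [sq_nonneg (‖a z.1‖ - ‖b (z.1 + z.2)‖), sq_nonneg ‖a z.1‖, sq_nonneg ‖b (z.1 + z.2)‖]

theorem integrable_pair {a b φ : R3 → ℝ} (ha : MemLp a 2 volume) (hb : MemLp b 2 volume)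
    (hφ : Integrable φ volume) :
    Integrable (fun z : R3 × R3 => a z.1 * b z.2 * φ (z.2 - z.1)) (volume.prod volume) := by
  have h := (measurePreserving_prod_add (volume : Measure R3) (volume : Measure R3)).integrable_comp_emb
    (MeasurableEquiv.shearAddRight R3).measurableEmbedding
    (g := fun z : R3 × R3 => a z.1 * b z.2 * φ (z.2 - z.1))
  rw [← h]
  simpa [Function.comp_def] using integrable_shift ha hb hφ

theorem integral_pair {a b φ : R3 → ℝ} (ha : MemLp a 2 volume) (hb : MemLp b 2 volume)
    (hφ : Integrable φ volume) :
    ∫ z : R3 × R3, a z.1 * b z.2 * φ (z.2 - z.1) ∂(volume.prod volume) =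
      ∫ t, φ t * ∫ x, a x * b (x + t) := by
  have h := (measurePreserving_prod_add (volume : Measure R3) (volume : Measure R3)).integral_comp
    (MeasurableEquiv.shearAddRight R3).measurableEmbedding
    (g := fun z : R3 × R3 => a z.1 * b z.2 * φ (z.2 - z.1))
  rw [← h]
  simp only [add_sub_cancel_left]
  rw [integral_prod_symm _ (integrable_shift ha hb hφ)]
  refine integral_congr_ae (Eventually.of_forall fun t => ?_)
  simp only [← integral_const_mul, mul_comm]

/-- The double integral averages the correlation of `a` and `b` against an approximate identity, so
it tends to the correlation at shift 0. -/
theorem tendsto_integral_pair {a b : R3 → ℝ} (ha : MemLp a 2 volume) (hb : MemLp b 2 volume)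
    {φ : ℕ → ContDiffBump (0 : R3)} (hφ : Tendsto (fun n => (φ n).rOut) atTop (𝓝 0)) :
    Tendsto (fun n => ∫ z : R3 × R3, a z.1 * b z.2 * (φ n).normed volume (z.2 - z.1)
      ∂(volume.prod volume)) atTop (𝓝 (∫ x, a x * b x)) := by
  have h := ContDiffBump.convolution_tendsto_right_of_continuous (μ := (volume : Measure R3)) hφ
    ((continuous_correlation ha hb).comp continuous_neg) 0
  simp only [convolution, Function.comp_apply, neg_zero, add_zero, zero_sub, neg_neg,
    ContinuousLinearMap.lsmul_apply, smul_eq_mul] at h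
  refine h.congr fun n => ?_
  rw [integral_pair ha hb (φ n).integrable_normed]

theorem memLp_mul_of_hasCompactSupport {a η : R3 → ℝ} (ha : MemLp a 2 volume) (hη : Continuous η)
    (hc : HasCompactSupport η) : MemLp (fun x => a x * η x) 2 volume :=
  (hη.memLp_top_of_hasCompactSupport hc volume).mul' ha

/-- The weak gradient of `u ^ 2` is `2 u g`. -/
theorem IsWeakGradient.integral_sq_mul_fderiv {u : R3 → ℝ} {g : R3 → R3} (h : IsWeakGradient u g)
    (hu : MemLp u 2 volume) (hg : MemLp g 2 volume) {η : R3 → ℝ} (hη : ContDiff ℝ ∞ η)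
    (hc : HasCompactSupport η) (v : R3) :
    ∫ x, u x ^ 2 * fderiv ℝ η x v = -(2 * ∫ x, u x * η x * ⟪v, g x⟫) := by
  have hgv : MemLp (fun x => ⟪v, g x⟫) 2 volume := hg.const_inner v
  have hdη : Continuous fun x => fderiv ℝ η x v :=
    (hη.continuous_fderiv (by simp)).clm_apply continuous_const
  have hdηc : HasCompactSupport fun x => fderiv ℝ η x v := hc.fderiv_apply ℝ v
  have huη := memLp_mul_of_hasCompactSupport hu hη.continuous hc
  have hudη := memLp_mul_of_hasCompactSupport hu hdη hdηc
  have hgη := memLp_mul_of_hasCompactSupport hgv hη.continuous hc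
  -- Doubling the variables avoids mollifying `u`: the weak derivative is used once in `y` (`e1`)
  -- and once in `x` (`e2`). The terms carrying the derivative of `φ (y - x)` cancel, so letting `φ`
  -- concentrate at 0 gives the product rule.
  have key : ∀ φ : R3 → ℝ, ContDiff ℝ ∞ φ → HasCompactSupport φ →
      ∫ z : R3 × R3, (u z.1 * fderiv ℝ η z.1 v) * u z.2 * φ (z.2 - z.1) ∂(volume.prod volume) =
      -(∫ z : R3 × R3, (u z.1 * η z.1) * ⟪v, g z.2⟫ * φ (z.2 - z.1) ∂(volume.prod volume)) -
      ∫ z : R3 × R3, (⟪v, g z.1⟫ * η z.1) * u z.2 * φ (z.2 - z.1) ∂(volume.prod volume) := by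
    intro φ hφ hφc
    have hφi : Integrable φ volume := hφ.continuous.integrable_of_hasCompactSupport hφc
    have hdφ : Continuous fun x => fderiv ℝ φ x v :=
      (hφ.continuous_fderiv (by simp)).clm_apply continuous_const
    have hdφi : Integrable (fun x => fderiv ℝ φ x v) volume :=
      hdφ.integrable_of_hasCompactSupport (hφc.fderiv_apply ℝ v)
    have e1 : ∫ z : R3 × R3, (u z.1 * η z.1) * u z.2 * fderiv ℝ φ (z.2 - z.1) v
        ∂(volume.prod volume) =
        -∫ z : R3 × R3, (u z.1 * η z.1) * ⟪v, g z.2⟫ * φ (z.2 - z.1) ∂(volume.prod volume) := by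
      rw [integral_prod _ (integrable_pair huη hu hdφi), integral_prod _ (integrable_pair huη hgv hφi),
        ← integral_neg]
      refine integral_congr_ae (Eventually.of_forall fun x => ?_)
      have hx := h.integral_mul_fderiv (φ := fun y => φ (y - x)) (by fun_prop)
        (hφc.comp_homeomorph (Homeomorph.subRight x)) v
      simp only [fderiv_comp_sub] at hx
      simp only [mul_assoc, integral_const_mul]
      rw [hx]
      simp only [mul_neg, mul_comm]
    have e2 : ∫ z : R3 × R3, (u z.1 * fderiv ℝ η z.1 v) * u z.2 * φ (z.2 - z.1)
          ∂(volume.prod volume) -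
        ∫ z : R3 × R3, (u z.1 * η z.1) * u z.2 * fderiv ℝ φ (z.2 - z.1) v ∂(volume.prod volume) =
        -∫ z : R3 × R3, (⟪v, g z.1⟫ * η z.1) * u z.2 * φ (z.2 - z.1) ∂(volume.prod volume) := by
      have i1 := integrable_pair hudη hu hφi
      have i2 := integrable_pair huη hu hdφi
      have i3 := integrable_pair hgη hu hφi
      have i4 := integral_prod_symm _ (i1.sub i2)
      simp only [Pi.sub_apply] at i4
      rw [← integral_sub i1 i2, i4, integral_prod_symm _ i3,
        ← integral_neg]
      refine integral_congr_ae (Eventually.of_forall fun y => ?_)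
      have hd : ∀ x, fderiv ℝ (fun x => η x * φ (y - x)) x v =
          fderiv ℝ η x v * φ (y - x) - η x * fderiv ℝ φ (y - x) v := by
        intro x
        have d1 : HasFDerivAt η (fderiv ℝ η x) x :=
          ((hη.differentiable (by simp)) x).hasFDerivAt
        have d2 : HasFDerivAt φ (fderiv ℝ φ (y - x)) (y - x) :=
          ((hφ.differentiable (by simp)) _).hasFDerivAt
        have d3 : HasFDerivAt (fun x => φ (y - x)) _ x :=
          d2.comp x ((hasFDerivAt_id x).const_sub y)
        rw [(d1.fun_mul d3).fderiv]
        simp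
        ring
      have hy := h.integral_mul_fderiv (φ := fun x => η x * φ (y - x)) (by fun_prop)
        hc.mul_right v
      simp only [hd] at hy
      calc _ = u y * ∫ x, u x * (fderiv ℝ η x v * φ (y - x) - η x * fderiv ℝ φ (y - x) v) := by
            rw [← integral_const_mul]
            refine integral_congr_ae (Eventually.of_forall fun x => ?_)
            ring
        _ = _ := by
            rw [hy, mul_neg, ← integral_const_mul]
            congr 2; ext x; ring
    linarith
  let φ : ℕ → ContDiffBump (0 : R3) := fun n =>
    ⟨1 / ((n : ℝ) + 1) / 2, 1 / ((n : ℝ) + 1), by positivity, half_lt_self (by positivity)⟩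
  have hφ : Tendsto (fun n => (φ n).rOut) atTop (𝓝 0) := tendsto_one_div_add_atTop_nhds_zero_nat
  have l1 := tendsto_integral_pair hudη hu hφ
  have l2 := (tendsto_integral_pair huη hgv hφ).neg.sub (tendsto_integral_pair hgη hu hφ)
  have := tendsto_nhds_unique (l1.congr fun n => key _ (φ n).contDiff_normed
    (φ n).hasCompactSupport_normed) l2
  calc _ = ∫ x, u x * fderiv ℝ η x v * u x := by congr 1; ext x; ring
    _ = _ := by
      rw [this]
      have : ∀ x, ⟪v, g x⟫ * η x * u x = u x * η x * ⟪v, g x⟫ := fun x => by ring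
      simp only [this]
      ring

/-! ### The local Coulomb inequality -/

/-- Integration by parts of `u ^ 2` against the vector field `η x • (x - X)`. -/
theorem IsWeakGradient.integral_sq_mul_radial {u : R3 → ℝ} {g : R3 → R3} (h : IsWeakGradient u g)
    (hu : MemLp u 2 volume) (hg : MemLp g 2 volume) {η : R3 → ℝ} (hη : ContDiff ℝ ∞ η)
    (hc : HasCompactSupport η) (X : R3) :
    ∫ x, u x ^ 2 * (fderiv ℝ η x (x - X) + 3 * η x) =
      -(2 * ∫ x, u x * η x * ⟪x - X, g x⟫) := by
  -- Each coordinate of `η x • (x - X)` is a valid test function. Adding the three identities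
  -- assembles the divergence, where `3 * η x` comes from the three coordinates.
  let b := EuclideanSpace.basisFun (Fin 3) ℝ
  have hs : ∀ i, ContDiff ℝ ∞ fun x => η x * ⟪b i, x - X⟫ := fun i =>
    hη.mul (contDiff_const.inner ℝ (contDiff_id.sub contDiff_const))
  have hsc : ∀ i, HasCompactSupport fun x => η x * ⟪b i, x - X⟫ := fun i => hc.mul_right
  have hd : ∀ i x, fderiv ℝ (fun x => η x * ⟪b i, x - X⟫) x (b i) =
      fderiv ℝ η x (⟪b i, x - X⟫ • b i) + η x := by
    intro i x
    have d1 : HasFDerivAt η (fderiv ℝ η x) x := (hη.differentiable (by simp) x).hasFDerivAt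
    have d2 : HasFDerivAt (fun x => ⟪b i, x - X⟫) (innerSL ℝ (b i)) x :=
      ((innerSL ℝ (b i)).hasFDerivAt).comp x ((hasFDerivAt_id x).sub_const X)
    rw [(d1.fun_mul d2).fderiv]
    simp [innerSL_apply_apply]
    ring
  have e : ∀ i, ∫ x, u x ^ 2 * (fderiv ℝ η x (⟪b i, x - X⟫ • b i) + η x) =
      -(2 * ∫ x, u x * (η x * ⟪b i, x - X⟫) * ⟪b i, g x⟫) := by
    intro i
    simp only [← hd]
    exact h.integral_sq_mul_fderiv hu hg (hs i) (hsc i) (b i)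
  have i1 : ∀ i ∈ Finset.univ,
      Integrable (fun x => u x ^ 2 * (fderiv ℝ η x (⟪b i, x - X⟫ • b i) + η x)) volume := by
    intro i _
    simp only [← hd]
    exact hu.integrable_sq.locallyIntegrable.integrable_smul_right_of_hasCompactSupport
      (((hs i).continuous_fderiv (by simp)).clm_apply continuous_const)
      ((hsc i).fderiv_apply ℝ (b i))
  have i2 : ∀ i ∈ Finset.univ,
      Integrable (fun x => u x * (η x * ⟪b i, x - X⟫) * ⟪b i, g x⟫) volume := fun i _ =>
    (memLp_mul_of_hasCompactSupport hu (hs i).continuous (hsc i)).integrable_mul (hg.const_inner _)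
  have es := Finset.sum_congr (rfl : (Finset.univ : Finset (Fin 3)) = Finset.univ) fun i _ => e i
  rw [Finset.sum_neg_distrib, ← Finset.mul_sum, ← integral_finsetSum _ i1,
    ← integral_finsetSum _ i2] at es
  have e1 : ∀ x, u x ^ 2 * (fderiv ℝ η x (x - X) + 3 * η x) =
      ∑ i, u x ^ 2 * (fderiv ℝ η x (⟪b i, x - X⟫ • b i) + η x) := fun x => by
    rw [← Finset.mul_sum, Finset.sum_add_distrib, ← map_sum, b.sum_repr']
    simp
  have e2 : ∀ x, u x * η x * ⟪x - X, g x⟫ =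
      ∑ i, u x * (η x * ⟪b i, x - X⟫) * ⟪b i, g x⟫ := fun x => by
    rw [← b.sum_inner_mul_inner, Finset.mul_sum]
    refine Finset.sum_congr rfl fun i _ => ?_
    rw [real_inner_comm (b i) (x - X)]
    ring
  simpa only [e1, e2] using es

/-- The norm of `y`, smoothed at the origin at scale `s`. -/
def softNorm (s : ℝ) (y : R3) : ℝ := √(‖y‖ ^ 2 + s ^ 2)

theorem softNorm_pos {s : ℝ} (hs : 0 < s) (y : R3) : 0 < softNorm s y :=
  Real.sqrt_pos.2 (by positivity)

theorem norm_le_softNorm (s : ℝ) (y : R3) : ‖y‖ ≤ softNorm s y :=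
  Real.le_sqrt_of_sq_le (by nlinarith [sq_nonneg s])

theorem softNorm_le {s : ℝ} (hs : 0 ≤ s) (y : R3) : softNorm s y ≤ ‖y‖ + s :=
  Real.sqrt_le_iff.2 ⟨by positivity, by nlinarith [norm_nonneg y]⟩

theorem contDiff_softNorm {s : ℝ} (hs : 0 < s) : ContDiff ℝ ∞ (softNorm s) := by
  unfold softNorm
  exact ((contDiff_norm_sq ℝ).add contDiff_const).sqrt fun y => by positivity

theorem hasFDerivAt_softNorm {s : ℝ} (hs : 0 < s) (y : R3) :
    HasFDerivAt (softNorm s) ((softNorm s y)⁻¹ • innerSL ℝ y) y := by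
  have h1 : HasFDerivAt (fun y : R3 => ‖y‖ ^ 2 + s ^ 2) (2 • innerSL ℝ y) y :=
    (hasStrictFDerivAt_norm_sq y).hasFDerivAt.add_const _
  refine HasFDerivAt.congr_fderiv (h1.sqrt (by positivity)) ?_
  change (1 / (2 * softNorm s y)) • (2 • innerSL ℝ y) = _
  rw [← Nat.cast_smul_eq_nsmul ℝ, smul_smul]
  congr 1
  field_simp [(softNorm_pos hs y).ne']
  norm_num

/-- The Coulomb inequality near `X`, with the singularity regularised. -/
theorem IsWeakGradient.coulomb_softNorm {u : R3 → ℝ} {g : R3 → R3} (h : IsWeakGradient u g)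
    (hu : MemLp u 2 volume) (hg : MemLp g 2 volume) {χ : R3 → ℝ} (hχ : ContDiff ℝ ∞ χ)
    (hc : HasCompactSupport χ) (hχ0 : ∀ x, 0 ≤ χ x) {C : ℝ} (hC : ∀ x, ‖fderiv ℝ χ x‖ ≤ C)
    {B : Set R3} (hB : MeasurableSet B) (hχB : ∀ x ∉ B, χ x = 0) (X : R3) {Z ε s : ℝ}
    (hZ : 0 ≤ Z) (hε : 0 < ε) (hs : 0 < s) :
    ∫ x, ε * (u x ^ 2 * (Z * χ x / softNorm s (x - X))) ≤
      ε ^ 2 * (∫ x in B, ‖g x‖ ^ 2) +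
        (Z ^ 2 / 4 * (∫ x, u x ^ 2 * χ x ^ 2) + ε * (Z / 2 * C * ∫ x, u x ^ 2)) := by
  have hsc : ContDiff ℝ ∞ fun x => softNorm s (x - X) :=
    (contDiff_softNorm hs).comp (contDiff_id.sub contDiff_const)
  have hpos : ∀ x, 0 < softNorm s (x - X) := fun x => softNorm_pos hs _
  -- `η x • (x - X)` is `Z / 2` times the cutoff times a smoothed unit radial field.
  let η : R3 → ℝ := fun x => χ x * (Z / 2 * (softNorm s (x - X))⁻¹)
  have hη : ContDiff ℝ ∞ η := hχ.mul (contDiff_const.mul (hsc.inv fun x => (hpos x).ne'))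
  have hηc : HasCompactSupport η := hc.mul_right
  have hd : ∀ x, fderiv ℝ η x (x - X) = Z / 2 * (fderiv ℝ χ x (x - X) / softNorm s (x - X) -
      χ x * ‖x - X‖ ^ 2 / softNorm s (x - X) ^ 3) := by
    intro x
    have d1 : HasFDerivAt χ (fderiv ℝ χ x) x := (hχ.differentiable (by simp) x).hasFDerivAt
    have d2 : HasFDerivAt (fun x => softNorm s (x - X))
        ((softNorm s (x - X))⁻¹ • innerSL ℝ (x - X)) x :=
      (hasFDerivAt_comp_sub X).2 (hasFDerivAt_softNorm hs (x - X))
    have d3 := ((hasDerivAt_inv (hpos x).ne').comp_hasFDerivAt x d2).const_mul (Z / 2)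
    have d4 : HasFDerivAt η _ x := d1.fun_mul d3
    rw [d4.fderiv]
    have := (hpos x).ne'
    simp only [add_apply, smul_apply, innerSL_apply_apply, smul_eq_mul, real_inner_self_eq_norm_sq]
    field_simp
    ring
  have key := h.integral_sq_mul_radial hu hg hη hηc X
  have iu := hu.integrable_sq
  have hcc : ∀ {f : R3 → ℝ}, Continuous f → HasCompactSupport f →
      Integrable (fun x => u x ^ 2 * f x) volume := fun hf hfc =>
    iu.locallyIntegrable.integrable_smul_right_of_hasCompactSupport hf hfc
  have iL : Integrable (fun x => u x ^ 2 * (Z * χ x / softNorm s (x - X))) volume := by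
    refine hcc ((hχ.continuous.const_mul Z).div hsc.continuous fun x => (hpos x).ne') ?_
    simp only [div_eq_mul_inv]
    exact hc.mul_left.mul_right
  have iD : Integrable (fun x => u x ^ 2 * (fderiv ℝ η x (x - X) + 3 * η x)) volume := by
    refine hcc (((hη.continuous_fderiv (by simp)).clm_apply (by fun_prop)).add
      (hη.continuous.const_mul 3)) ?_
    refine HasCompactSupport.add ?_ hηc.mul_left
    exact (hηc.fderiv ℝ).mono fun x hx h0 => hx (by simp [h0])
  have iχ : Integrable (fun x => u x ^ 2 * χ x ^ 2) volume := by
    refine hcc (hχ.continuous.pow 2) ?_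
    simp only [sq]
    exact hc.mul_right
  have ig : Integrable (fun x => ‖g x‖ ^ 2) volume := hg.norm.integrable_sq
  have iG : Integrable (fun x => u x * η x * ⟪x - X, g x⟫) volume := by
    have m1 := memLp_mul_of_hasCompactSupport hu (η := fun x => η x * ‖x - X‖)
      (hη.continuous.mul (by fun_prop)) hηc.mul_right
    refine (m1.integrable_mul hg.norm).norm.mono' ((hu.aestronglyMeasurable.mul
      hη.continuous.aestronglyMeasurable).mul (AEStronglyMeasurable.inner
      (by fun_prop : Continuous fun x : R3 => x - X).aestronglyMeasurable
      hg.aestronglyMeasurable)) (Eventually.of_forall fun x => ?_)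
    simp only [Pi.mul_apply, norm_mul, norm_norm, mul_assoc]
    gcongr
    exact norm_inner_le_norm _ _
  -- The divergence is `Z / 2` times at least `3 χ / p - χ / p - C`: the dimension gives 3, the
  -- decay of `1 / p` removes at most 1, and the cutoff costs `C`.
  have low : ∫ x, u x ^ 2 * (Z * χ x / softNorm s (x - X)) ≤
      (∫ x, u x ^ 2 * (fderiv ℝ η x (x - X) + 3 * η x)) + Z / 2 * C * ∫ x, u x ^ 2 := by
    rw [← integral_const_mul, ← integral_add iD (iu.const_mul _)]
    refine integral_mono iL (iD.add (iu.const_mul _)) fun x => ?_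
    simp only []
    rw [mul_comm (Z / 2 * C) (u x ^ 2), ← mul_add]
    gcongr
    rw [hd]
    have hp := hpos x
    set p := softNorm s (x - X) with hp'
    have hr : ‖x - X‖ ≤ p := norm_le_softNorm s _
    have hC0 : 0 ≤ C := (norm_nonneg _).trans (hC x)
    have h1 : -C ≤ fderiv ℝ χ x (x - X) / p := by
      rw [le_div_iff₀ hp]
      have := (abs_le.1 ((fderiv ℝ χ x).le_of_opNorm_le (hC x) (x - X))).1
      nlinarith
    have h2 : χ x * ‖x - X‖ ^ 2 / p ^ 3 ≤ χ x / p := by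
      rw [div_le_div_iff₀ (by positivity) hp]
      have : ‖x - X‖ ^ 2 ≤ p ^ 2 := by gcongr
      nlinarith [mul_le_mul_of_nonneg_left this (mul_nonneg (hχ0 x) hp.le)]
    have h3 : Z * χ x / p = Z / 2 * (2 * (χ x / p)) := by ring
    have h4 : 3 * η x = Z / 2 * (3 * (χ x / p)) := by simp only [η, hp']; ring
    rw [h3, h4]
    have : 0 ≤ Z / 2 := by positivity
    nlinarith
  -- Completing the square in `ε g + u η (x - X)` on `B`; outside `B` the cutoff vanishes, so only
  -- the kinetic energy inside `B` is spent.
  have up : ε * (-(2 * ∫ x, u x * η x * ⟪x - X, g x⟫)) ≤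
      ε ^ 2 * (∫ x in B, ‖g x‖ ^ 2) + Z ^ 2 / 4 * ∫ x, u x ^ 2 * χ x ^ 2 := by
    rw [← integral_indicator hB, ← integral_const_mul, ← integral_const_mul, ← integral_const_mul,
      ← integral_neg, ← integral_const_mul,
      ← integral_add ((ig.indicator hB).const_mul _) (iχ.const_mul _)]
    refine integral_mono ((iG.const_mul 2).neg.const_mul ε)
      (((ig.indicator hB).const_mul _).add (iχ.const_mul _)) fun x => ?_
    simp only []
    by_cases hx : x ∈ B
    · rw [Set.indicator_of_mem hx]
      have hp := hpos x
      have hr : ‖x - X‖ ≤ softNorm s (x - X) := norm_le_softNorm s _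
      have h1 : η x * ‖x - X‖ ≤ Z / 2 * χ x := by
        have : (softNorm s (x - X))⁻¹ * ‖x - X‖ ≤ 1 := by
          rw [inv_mul_le_iff₀ hp]; simpa using hr
        calc _ = (Z / 2 * χ x) * ((softNorm s (x - X))⁻¹ * ‖x - X‖) := by simp only [η]; ring
          _ ≤ (Z / 2 * χ x) * 1 := by
            have := hχ0 x
            gcongr
          _ = _ := mul_one _
      have h0 : 0 ≤ η x * ‖x - X‖ :=
        mul_nonneg (mul_nonneg (hχ0 x) (mul_nonneg (by positivity) (inv_nonneg.2 hp.le)))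
          (norm_nonneg _)
      have h2 : (η x * ‖x - X‖) ^ 2 ≤ Z ^ 2 / 4 * χ x ^ 2 := by
        calc _ ≤ (Z / 2 * χ x) ^ 2 := by gcongr
          _ = _ := by ring
      have h3 := norm_add_sq_real (ε • g x) ((u x * η x) • (x - X))
      rw [norm_smul, norm_smul, real_inner_smul_left, real_inner_smul_right, mul_pow, mul_pow,
        Real.norm_eq_abs, Real.norm_eq_abs, sq_abs, sq_abs, real_inner_comm] at h3
      have h4 := sq_nonneg ‖ε • g x + (u x * η x) • (x - X)‖
      have h5 := mul_le_mul_of_nonneg_left h2 (sq_nonneg (u x))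
      nlinarith
    · rw [Set.indicator_of_notMem hx]
      simp [η, hχB x hx]
  rw [integral_const_mul]
  rw [key] at low
  nlinarith [mul_le_mul_of_nonneg_left low hε.le]

/-- The Coulomb inequality near `X`. -/
theorem IsWeakGradient.coulomb_local {u : R3 → ℝ} {g : R3 → R3} (h : IsWeakGradient u g)
    (hu : MemLp u 2 volume) (hg : MemLp g 2 volume) {χ : R3 → ℝ} (hχ : ContDiff ℝ ∞ χ)
    (hc : HasCompactSupport χ) (hχ0 : ∀ x, 0 ≤ χ x) {C : ℝ} (hC : ∀ x, ‖fderiv ℝ χ x‖ ≤ C)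
    {B : Set R3} (hB : MeasurableSet B) (hχB : ∀ x ∉ B, χ x = 0) (X : R3) {Z ε : ℝ}
    (hZ : 0 ≤ Z) (hε : 0 < ε) :
    ENNReal.ofReal ε * ∫⁻ x, ENNReal.ofReal (u x ^ 2) * (ENNReal.ofReal (Z * χ x) / ‖x - X‖ₑ) ≤
      ENNReal.ofReal (ε ^ 2) * (∫⁻ x in B, ‖g x‖ₑ ^ 2) +
        ENNReal.ofReal (Z ^ 2 / 4 * (∫ x, u x ^ 2 * χ x ^ 2) +
          ε * (Z / 2 * C * ∫ x, u x ^ 2)) := by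
  -- The regularised bounds are uniform in the smoothing scale, so Fatou's lemma gives the singular
  -- one without assuming the Coulomb integral finite.
  let F : ℕ → R3 → ℝ := fun n x =>
    ε * (u x ^ 2 * (Z * χ x / softNorm (1 / ((n : ℝ) + 1)) (x - X)))
  have hn : ∀ n : ℕ, 0 < 1 / ((n : ℝ) + 1) := fun n => by positivity
  have hC0 : 0 ≤ C := (norm_nonneg _).trans (hC 0)
  have ig : Integrable (fun x => ‖g x‖ ^ 2) volume := hg.norm.integrable_sq
  have hFc : ∀ n : ℕ, Continuous fun x => Z * χ x / softNorm (1 / ((n : ℝ) + 1)) (x - X) := fun n =>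
    (hχ.continuous.const_mul Z).div
      ((contDiff_softNorm (hn n)).continuous.comp (continuous_id.sub continuous_const))
      fun x => (softNorm_pos (hn n) _).ne'
  have hFi : ∀ n, Integrable (F n) volume := fun n => by
    refine Integrable.const_mul ?_ _
    refine hu.integrable_sq.locallyIntegrable.integrable_smul_right_of_hasCompactSupport (hFc n) ?_
    simp only [div_eq_mul_inv]
    exact hc.mul_left.mul_right
  have hF0 : ∀ n x, 0 ≤ F n x := fun n x => by
    have := (softNorm_pos (hn n) (x - X)).le
    have := hχ0 x
    positivity
  have hgB : ENNReal.ofReal (∫ x in B, ‖g x‖ ^ 2) = ∫⁻ x in B, ‖g x‖ₑ ^ 2 := by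
    rw [ofReal_integral_eq_lintegral_ofReal ig.integrableOn
      (Eventually.of_forall fun x => by positivity)]
    simp only [ENNReal.ofReal_pow (norm_nonneg _), ofReal_norm]
  have bound : ∀ n, ∫⁻ x, ENNReal.ofReal (F n x) ≤
      ENNReal.ofReal (ε ^ 2) * (∫⁻ x in B, ‖g x‖ₑ ^ 2) +
        ENNReal.ofReal (Z ^ 2 / 4 * (∫ x, u x ^ 2 * χ x ^ 2) +
          ε * (Z / 2 * C * ∫ x, u x ^ 2)) := by
    intro n
    rw [← ofReal_integral_eq_lintegral_ofReal (hFi n) (Eventually.of_forall (hF0 n)), ← hgB,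
      ← ENNReal.ofReal_mul (by positivity), ← ENNReal.ofReal_add (by positivity) (by positivity)]
    exact ENNReal.ofReal_le_ofReal (h.coulomb_softNorm hu hg hχ hc hχ0 hC hB hχB X hZ hε (hn n))
  rw [← lintegral_const_mul' _ _ ENNReal.ofReal_ne_top]
  have hlim : ∀ᵐ x, ENNReal.ofReal ε *
      (ENNReal.ofReal (u x ^ 2) * (ENNReal.ofReal (Z * χ x) / ‖x - X‖ₑ)) =
        liminf (fun n => ENNReal.ofReal (F n x)) atTop := by
    have hne : ∀ᵐ x : R3, x ≠ X := by
      rw [ae_iff]; simp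
    filter_upwards [hne] with x hx
    have hy : 0 < ‖x - X‖ := norm_pos_iff.2 (sub_ne_zero.2 hx)
    have t1 : Tendsto (fun n : ℕ => softNorm (1 / ((n : ℝ) + 1)) (x - X)) atTop (𝓝 ‖x - X‖) := by
      have := ((tendsto_one_div_add_atTop_nhds_zero_nat (𝕜 := ℝ)).pow 2).const_add (‖x - X‖ ^ 2)
      have := (Real.continuous_sqrt.tendsto _).comp this
      simpa [softNorm, Function.comp_def, Real.sqrt_sq hy.le] using this
    have t2 : Tendsto (fun n => ENNReal.ofReal (F n x)) atTop
        (𝓝 (ENNReal.ofReal (ε * (u x ^ 2 * (Z * χ x / ‖x - X‖))))) :=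
      ENNReal.tendsto_ofReal
        (((tendsto_const_nhds.div t1 hy.ne').const_mul (u x ^ 2)).const_mul ε)
    rw [t2.liminf_eq, ENNReal.ofReal_mul hε.le, ENNReal.ofReal_mul (sq_nonneg _),
      ENNReal.ofReal_div_of_pos hy, ofReal_norm]
  rw [lintegral_congr_ae hlim]
  refine (lintegral_liminf_le' fun n => (hFi n).aemeasurable.ennreal_ofReal).trans ?_
  exact liminf_le_of_frequently_le' (Eventually.of_forall bound).frequently

/-! ### The lower bound -/

instance (σ : SubProb) : IsFiniteMeasure σ.toMeasure := ⟨σ.2.trans_lt ENNReal.one_lt_top⟩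

theorem sqrtDensity_sq (ρ : Measure R3) (x : R3) :
    sqrtDensity ρ x ^ 2 = (ρ.rnDeriv volume x).toReal :=
  Real.sq_sqrt ENNReal.toReal_nonneg

theorem ofReal_sqrtDensity_sq (ρ : Measure R3) [IsFiniteMeasure ρ] :
    ∀ᵐ x, ENNReal.ofReal (sqrtDensity ρ x ^ 2) = ρ.rnDeriv volume x := by
  filter_upwards [ρ.rnDeriv_lt_top volume] with x hx
  rw [sqrtDensity_sq, ENNReal.ofReal_toReal hx.ne]

theorem lintegral_sqrtDensity_sq_mul {ρ : Measure R3} [IsFiniteMeasure ρ] (hρ : ρ ≪ volume)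
    {f : R3 → ℝ≥0∞} (hf : Measurable f) :
    ∫⁻ x, ENNReal.ofReal (sqrtDensity ρ x ^ 2) * f x = ∫⁻ x, f x ∂ρ := by
  rw [← lintegral_rnDeriv_mul hρ hf.aemeasurable]
  refine lintegral_congr_ae ?_
  filter_upwards [ofReal_sqrtDensity_sq ρ] with x hx
  rw [hx]

theorem memLp_two_of_lintegral_lt_top {E : Type*} [NormedAddCommGroup E] {f : R3 → E}
    (hf : AEStronglyMeasurable f volume) (h : ∫⁻ x, ‖f x‖ₑ ^ 2 < ⊤) : MemLp f 2 volume := by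
  refine ⟨hf, ?_⟩
  rw [eLpNorm_lt_top_iff_lintegral_rpow_enorm_lt_top (by simp) (by simp)]
  simpa using h

/-- Finiteness of `a` excludes `⊤ - ⊤`, which is `⊥` in `EReal`. -/
theorem coe_neg_le_sub {a b : ℝ≥0∞} {R : ℝ} (hR : 0 ≤ R) (ha : a ≠ ⊤)
    (h : b ≤ a + ENNReal.ofReal R) : ((-R : ℝ) : EReal) ≤ (a : EReal) - (b : EReal) := by
  have hb : b ≠ ⊤ := ne_top_of_le_ne_top (by finiteness) h
  lift a to NNReal using ha
  lift b to NNReal using hb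
  have h' : (b : ℝ) ≤ a + R := by
    have := ENNReal.toReal_mono (by finiteness) h
    rwa [ENNReal.toReal_add (by finiteness) (by finiteness), ENNReal.toReal_ofReal hR] at this
  change ((-R : ℝ) : EReal) ≤ ((a : ℝ) : EReal) - ((b : ℝ) : EReal)
  rw [← EReal.coe_sub, EReal.coe_le_coe_iff]
  linarith

/-- Beyond distance `δ` the potential is at most `Z / δ`, and the total mass is one. -/
theorem lintegral_coulomb_le_of_cutoff {ρ : Measure R3} [IsProbabilityMeasure ρ] {χ : R3 → ℝ}
    {X : R3} {δ Z : ℝ} (hδ : 0 < δ) (hZ : 0 ≤ Z)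
    (hχ1 : ∀ x ∈ Metric.closedBall X δ, χ x = 1) :
    ∫⁻ x, ENNReal.ofReal Z / ‖x - X‖ₑ ∂ρ ≤
      (∫⁻ x, ENNReal.ofReal (Z * χ x) / ‖x - X‖ₑ ∂ρ) + ENNReal.ofReal (Z / δ) := by
  have h1 : ∫⁻ _, ENNReal.ofReal (Z / δ) ∂ρ = ENNReal.ofReal (Z / δ) := by simp
  rw [← h1, ← lintegral_add_right _ measurable_const]
  refine lintegral_mono fun x => ?_
  by_cases hx : x ∈ Metric.closedBall X δ
  · rw [hχ1 x hx, mul_one]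
    exact le_self_add
  · rw [Metric.mem_closedBall, dist_eq_norm, not_le] at hx
    rw [← ofReal_norm (x - X), ← ENNReal.ofReal_div_of_pos (hδ.trans hx)]
    refine le_add_left (ENNReal.ofReal_le_ofReal ?_)
    gcongr

/-- The energy is bounded below by the masses near the nuclei. -/
theorem le_energy {M : ℕ} {Z : Fin M → ℝ} (hZ : ∀ k, 0 < Z k) {X : Fin M → R3} {δ : ℝ}
    (hδ : 0 < δ) (χ : ∀ k, ContDiffBump (X k)) (hin : ∀ k, (χ k).rIn = δ)
    (hdisj : Pairwise fun i j => Disjoint (Metric.ball (X i) (χ i).rOut)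
      (Metric.ball (X j) (χ j).rOut))
    {C : Fin M → ℝ} (hC : ∀ k x, ‖fderiv ℝ (χ k) x‖ ≤ C k) {ε : ℝ} (hε : 0 < ε) (σ : SubProb) :
    ((-(∑ k, Z k ^ 2 / 4 * (∫ x, χ k x ^ 2 ∂σ.toMeasure) +
      ε * ∑ k, (Z k / 2 * C k + Z k / δ)) : ℝ) : EReal) ≤ energy Z X ε σ := by
  unfold energy
  split_ifs with hσ
  swap
  · exact le_top
  obtain ⟨hone, hac, hu, g₀, hg₀, hw₀⟩ := hσ
  have : IsProbabilityMeasure σ.toMeasure := ⟨hone⟩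
  have hC0 : ∀ k, 0 ≤ C k := fun k => (norm_nonneg _).trans (hC k 0)
  have hχ2 : ∀ k, 0 ≤ ∫ x, χ k x ^ 2 ∂σ.toMeasure := fun k =>
    integral_nonneg fun x => sq_nonneg _
  have hZ0 : ∀ k, 0 ≤ Z k := fun k => (hZ k).le
  have hsum : 0 ≤ ∑ k, (Z k / 2 * C k + Z k / δ) := Finset.sum_nonneg fun k _ => by
    have := hC0 k; have := hZ0 k; positivity
  have hsum2 : 0 ≤ ∑ k, Z k ^ 2 / 4 * (∫ x, χ k x ^ 2 ∂σ.toMeasure) :=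
    Finset.sum_nonneg fun k _ => by have := hχ2 k; positivity
  have hkin : kinetic σ.toMeasure ≠ ⊤ := by
    refine ne_top_of_le_ne_top ?_ (iInf₂_le g₀ hw₀)
    have := hg₀.norm.integrable_sq.lintegral_lt_top
    simpa only [ENNReal.ofReal_pow (norm_nonneg _), ofReal_norm] using this.ne
  refine coe_neg_le_sub (by positivity) (by finiteness) ?_
  unfold kinetic
  have hε2 : ENNReal.ofReal (ε ^ 2) ≠ 0 := by
    simpa using hε.ne'
  -- The bound is proved for every weak gradient in the infimum, so uniqueness of the weak gradient
  -- is not needed.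
  simp only [ENNReal.mul_iInf_of_ne hε2 ENNReal.ofReal_ne_top, ENNReal.iInf_add]
  refine le_iInf₂ fun g hw => ?_
  by_cases hgt : ∫⁻ x, ‖g x‖ₑ ^ 2 = ⊤
  · rw [hgt, ENNReal.mul_top hε2, top_add]
    exact le_top
  have hg := memLp_two_of_lintegral_lt_top hw.2.1.aestronglyMeasurable (Ne.lt_top hgt)
  have hu2 : ∫ x, sqrtDensity σ.toMeasure x ^ 2 = 1 := by
    simp only [sqrtDensity_sq]
    rw [Measure.integral_toReal_rnDeriv hac, probReal_univ]
  have local_bound : ∀ k, ENNReal.ofReal ε * ∫⁻ x, ENNReal.ofReal (Z k) / ‖x - X k‖ₑ ∂σ.toMeasure ≤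
      ENNReal.ofReal (ε ^ 2) * (∫⁻ x in Metric.ball (X k) (χ k).rOut, ‖g x‖ₑ ^ 2) +
      ENNReal.ofReal (Z k ^ 2 / 4 * (∫ x, χ k x ^ 2 ∂σ.toMeasure) +
        ε * (Z k / 2 * C k + Z k / δ)) := by
    intro k
    have hm : Measurable (χ k) := (χ k).continuous.measurable
    have h1 := hw.coulomb_local hu hg (χ k).contDiff (χ k).hasCompactSupport
      (fun x => (χ k).nonneg) (hC k) Metric.isOpen_ball.measurableSet (fun x hx => by
        by_contra h0
        exact hx ((χ k).support_eq ▸ Function.mem_support.2 h0)) (X k) (hZ0 k) hε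
    have h2 := lintegral_coulomb_le_of_cutoff (ρ := σ.toMeasure) (χ := χ k) hδ (hZ0 k)
      (X := X k) (fun x hx => (χ k).one_of_mem_closedBall (by rwa [hin k]))
    rw [lintegral_sqrtDensity_sq_mul hac (by fun_prop)] at h1
    have h3 : ∫ x, sqrtDensity σ.toMeasure x ^ 2 * χ k x ^ 2 = ∫ x, χ k x ^ 2 ∂σ.toMeasure := by
      simp only [sqrtDensity_sq]
      exact integral_toReal_rnDeriv_mul hac
    rw [h3, hu2, mul_one] at h1
    have := hχ2 k
    have := hC0 k
    have := hZ0 k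
    calc _ ≤ ENNReal.ofReal ε * ((∫⁻ x, ENNReal.ofReal (Z k * χ k x) / ‖x - X k‖ₑ ∂σ.toMeasure) +
          ENNReal.ofReal (Z k / δ)) := by gcongr
      _ ≤ _ := by
        rw [mul_add, ← ENNReal.ofReal_mul hε.le]
        refine (add_le_add_left h1 _).trans_eq ?_
        rw [add_assoc, ← ENNReal.ofReal_add (by positivity) (by positivity)]
        congr 2
        ring
  have hpot : potential Z X σ.toMeasure =
      ∑ k, ∫⁻ x, ENNReal.ofReal (Z k) / ‖x - X k‖ₑ ∂σ.toMeasure := by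
    unfold potential
    exact lintegral_finsetSum _ fun k _ => by fun_prop
  rw [hpot, Finset.mul_sum]
  refine (Finset.sum_le_sum fun k _ => local_bound k).trans ?_
  -- Disjointness of the balls lets the local kinetic energies add up to at most the whole.
  rw [Finset.sum_add_distrib, ← Finset.mul_sum, ← lintegral_biUnion_finset
    (fun i _ j _ hij => hdisj hij) (fun k _ => Metric.isOpen_ball.measurableSet),
    ← ENNReal.ofReal_sum_of_nonneg fun k _ => by
      have := hχ2 k; have := hC0 k; have := hZ0 k; positivity,
    Finset.sum_add_distrib, ← Finset.mul_sum]
  gcongr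
  exact Measure.restrict_le_self

theorem exists_bound_fderiv_bump {X : R3} (χ : ContDiffBump X) :
    ∃ C, ∀ x, ‖fderiv ℝ χ x‖ ≤ C :=
  ((χ.contDiff (n := 1)).continuous_fderiv (by simp)).bounded_above_of_compact_support
    (χ.hasCompactSupport.fderiv ℝ)

theorem continuous_integral (F : C₀(R3, ℝ)) :
    Continuous fun σ : SubProb => ∫ x, F x ∂σ.toMeasure :=
  (continuous_apply F).comp (continuous_induced_dom
    (f := fun (ρ : SubProb) (f : C₀(R3, ℝ)) => ∫ x, f x ∂ρ.toMeasure))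

theorem eventually_integral_lt (ρ : SubProb) {f : R3 → ℝ} (hf : Continuous f)
    (hc : HasCompactSupport f) {c : ℝ} (h : ∫ x, f x ∂ρ.toMeasure < c) :
    ∀ᶠ σ in 𝓝 ρ, ∫ x, f x ∂σ.toMeasure < c := by
  let F : C₀(R3, ℝ) := ⟨⟨f, hf⟩, hc.is_zero_at_infty⟩
  exact (continuous_integral F).continuousAt.eventually_lt continuousAt_const h

theorem tendsto_measureReal_closedBall (μ : Measure R3) [IsFiniteMeasure μ] (x : R3) :
    Tendsto (fun δ => μ.real (Metric.closedBall x δ)) (𝓝[>] 0) (𝓝 (μ.real {x})) := by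
  have h := tendsto_measure_cthickening_of_isCompact (μ := μ) (isCompact_singleton (x := x))
  have h2 := (ENNReal.tendsto_toReal (measure_ne_top μ _)).comp 
    (h.mono_left (nhdsWithin_le_nhds (s := Set.Ioi 0)))
  refine h2.congr' ?_
  filter_upwards [self_mem_nhdsWithin] with δ hδ
  rw [Function.comp_apply, Metric.cthickening_singleton x (le_of_lt hδ), measureReal_def]

theorem limitEnergy_le_gammaLiminf {M : ℕ} {Z : Fin M → ℝ} (hZ : ∀ k, 0 < Z k)
    {X : Fin M → R3} (hX : Function.Injective X) (ρ : SubProb) :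
    limitEnergy Z X ρ ≤ gammaLiminf (𝓝[>] (0 : ℝ)) (energy Z X) ρ := by
  refine EReal.ge_of_forall_gt_iff_ge.1 fun c hc => ?_
  rw [limitEnergy, EReal.coe_lt_coe_iff] at hc
  -- The slack `τ` is spent twice: on the extra mass allowed near each nucleus, and on the remainder
  -- of order `ε`.
  have ht : Tendsto (fun τ : ℝ => -(∑ k, Z k ^ 2 / 4 * (ρ.toMeasure.real {X k} + τ) + τ))
      (𝓝[>] 0) (𝓝 (-(1 / 4) * ∑ k, Z k ^ 2 * (ρ.toMeasure {X k}).toReal)) := by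
    have : Continuous fun τ : ℝ => -(∑ k, Z k ^ 2 / 4 * (ρ.toMeasure.real {X k} + τ) + τ) := by
      fun_prop
    convert (this.tendsto 0).mono_left nhdsWithin_le_nhds using 2
    simp only [measureReal_def, add_zero, Finset.mul_sum, ← Finset.sum_neg_distrib]
    exact Finset.sum_congr rfl fun k _ => by ring
  obtain ⟨τ, hcτ, hτ⟩ := ((ht.eventually_const_lt hc).and self_mem_nhdsWithin).exists
  have hball : ∀ᶠ δ in 𝓝[>] (0 : ℝ), ∀ k,
      ρ.toMeasure.real (Metric.closedBall (X k) δ) < ρ.toMeasure.real {X k} + τ :=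
    eventually_all.2 fun k => (tendsto_measureReal_closedBall ρ.toMeasure (X k)).eventually_lt_const
      (by linarith)
  have hsep : ∀ᶠ δ in 𝓝[>] (0 : ℝ), ∀ i j, i ≠ j → δ + δ ≤ dist (X i) (X j) := by
    refine eventually_all.2 fun i => eventually_all.2 fun j => ?_
    by_cases hij : i = j
    · exact Eventually.of_forall fun _ h => absurd hij h
    · have hd : 0 < dist (X i) (X j) := dist_pos.2 fun h => hij (hX h)
      have : Tendsto (fun δ : ℝ => δ + δ) (𝓝[>] 0) (𝓝 0) := by
        have h : Continuous fun δ : ℝ => δ + δ := by fun_prop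
        simpa using (h.tendsto 0).mono_left nhdsWithin_le_nhds
      filter_upwards [this.eventually_lt_const hd] with δ hδ _ using hδ.le
  obtain ⟨δ, ⟨hδb, hδs⟩, hδ⟩ := ((hball.and hsep).and self_mem_nhdsWithin).exists
  let χ : ∀ k, ContDiffBump (X k) := fun k => ⟨δ / 2, δ, half_pos hδ, half_lt_self hδ⟩
  choose C hC using fun k => exists_bound_fderiv_bump (χ k)
  have hχlt : ∀ k, ∫ x, χ k x ^ 2 ∂ρ.toMeasure < ρ.toMeasure.real {X k} + τ := by
    intro k
    refine lt_of_le_of_lt ?_ (hδb k)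
    rw [← integral_indicator_one Metric.isClosed_closedBall.measurableSet]
    refine integral_mono_of_nonneg (Eventually.of_forall fun x => sq_nonneg _)
      ((integrable_const 1).indicator Metric.isClosed_closedBall.measurableSet)
      (Eventually.of_forall fun x => ?_)
    by_cases hx : x ∈ Metric.closedBall (X k) δ
    · simp only [Set.indicator_of_mem hx, Pi.one_apply]
      exact pow_le_one₀ (χ k).nonneg (χ k).le_one
    · simp only [Set.indicator_of_notMem hx]
      rw [(χ k).zero_of_le_dist (by
        rw [Metric.mem_closedBall, not_le] at hx
        exact hx.le)]
      simp
  -- An upper bound on the cutoff masses suffices, since they enter the energy bound with a minus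
  -- sign.
  have hU : {σ : SubProb | ∀ k, ∫ x, χ k x ^ 2 ∂σ.toMeasure < ρ.toMeasure.real {X k} + τ} ∈ 𝓝 ρ := by
    refine eventually_all.2 fun k => eventually_integral_lt ρ ((χ k).continuous.pow 2) ?_ (hχlt k)
    rw [sq]
    exact (χ k).hasCompactSupport.mul_right
  refine le_trans ?_ (le_iSup₂ _ hU)
  refine le_liminf_of_le (by isBoundedDefault) ?_
  have hsmall : ∀ᶠ ε in 𝓝[>] (0 : ℝ), ε * ∑ k, (Z k / 2 * C k + Z k / (δ / 2)) < τ := by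
    have h : Continuous fun ε : ℝ => ε * ∑ k, (Z k / 2 * C k + Z k / (δ / 2)) := by fun_prop
    have h' := (h.tendsto 0).mono_left (nhdsWithin_le_nhds (s := Set.Ioi 0))
    rw [zero_mul] at h'
    exact h'.eventually_lt_const hτ
  filter_upwards [hsmall, self_mem_nhdsWithin] with ε hε hε0
  refine le_iInf₂ fun σ hσ => ?_
  refine le_trans ?_ (le_energy hZ (half_pos hδ) χ (fun k => rfl)
    (fun i j hij => Metric.ball_disjoint_ball (hδs i j hij)) hC hε0 σ)
  rw [EReal.coe_le_coe_iff]
  refine hcτ.le.trans (neg_le_neg (add_le_add ?_ hε.le))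
  refine Finset.sum_le_sum fun k _ => ?_
  have := (hσ k).le
  gcongr

/-! ### Concentrated profiles -/

theorem integral_exp_neg_two_mul_norm :
    ∫ x : R3, Real.exp (-(2 * ‖x‖)) = 3 * volume.real (Metric.ball (0 : R3) 1) * (1 / 4) := by
  have h := integral_fun_norm_addHaar (volume : Measure R3) fun r : ℝ => Real.exp (-(2 * r))
  have h2 := Real.integral_rpow_mul_exp_neg_mul_Ioi (a := 3) (r := 2) (by norm_num) (by norm_num)
  have hG : Real.Gamma 3 = 2 := by
    norm_num [Nat.factorial]
  rw [hG] at h2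
  norm_num at h2
  rw [h]
  simp only [finrank_euclideanSpace, Fintype.card_fin, smul_eq_mul, nsmul_eq_mul]
  norm_num
  rw [h2]
  ring

/-- The value agrees with `integral_exp_neg_two_mul_norm`: for the normalised density proportional
to `exp (-2 |x|)` the mean of `1 / |x|` is exactly 1. -/
theorem integral_exp_neg_two_mul_norm_div :
    ∫ x : R3, Real.exp (-(2 * ‖x‖)) / ‖x‖ =
      3 * volume.real (Metric.ball (0 : R3) 1) * (1 / 4) := by
  have h := integral_fun_norm_addHaar (volume : Measure R3) fun r : ℝ => Real.exp (-(2 * r)) / r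
  have h2 := Real.integral_rpow_mul_exp_neg_mul_Ioi (a := 2) (r := 2) (by norm_num) (by norm_num)
  have hG : Real.Gamma 2 = 1 := Real.Gamma_two
  rw [hG] at h2
  norm_num at h2
  rw [h]
  simp only [finrank_euclideanSpace, Fintype.card_fin, smul_eq_mul, nsmul_eq_mul]
  have h3 : ∫ y in Set.Ioi (0 : ℝ), y ^ (3 - 1) * (Real.exp (-(2 * y)) / y) =
      ∫ t in Set.Ioi (0 : ℝ), t * Real.exp (-(2 * t)) := by
    refine setIntegral_congr_fun measurableSet_Ioi fun y hy => ?_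
    have : y ≠ 0 := (Set.mem_Ioi.1 hy).ne'
    field_simp
  rw [h3, h2]
  norm_num
  ring

theorem volume_real_ball_pos : 0 < volume.real (Metric.ball (0 : R3) 1) :=
  ENNReal.toReal_pos (Metric.measure_ball_pos _ _ one_pos).ne' measure_ball_lt_top.ne

/-- A non-integrable function has Bochner integral 0, so a nonzero value proves integrability. -/
theorem integrable_exp_neg_two_mul_norm : Integrable fun x : R3 => Real.exp (-(2 * ‖x‖)) := by
  refine .of_integral_ne_zero ?_
  rw [integral_exp_neg_two_mul_norm]
  have := volume_real_ball_pos
  positivity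

theorem integrable_exp_neg_two_mul_norm_div :
    Integrable fun x : R3 => Real.exp (-(2 * ‖x‖)) / ‖x‖ := by
  refine .of_integral_ne_zero ?_
  rw [integral_exp_neg_two_mul_norm_div]
  have := volume_real_ball_pos
  positivity

/-- The smoothed exponential `exp (-2 |x|)`. -/
def smoothExp (θ : ℝ) (x : R3) : ℝ := Real.exp (-(2 * softNorm θ x))

theorem smoothExp_pos (θ : ℝ) (x : R3) : 0 < smoothExp θ x := Real.exp_pos _

theorem contDiff_smoothExp {θ : ℝ} (hθ : 0 < θ) : ContDiff ℝ ∞ (smoothExp θ) :=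
  (contDiff_const.mul (contDiff_softNorm hθ)).neg.exp

theorem smoothExp_le (θ : ℝ) (x : R3) : smoothExp θ x ≤ Real.exp (-(2 * ‖x‖)) :=
  Real.exp_le_exp.2 (by linarith [norm_le_softNorm θ x])

theorem le_smoothExp {θ : ℝ} (hθ : 0 < θ) (x : R3) :
    Real.exp (-(2 * θ)) * Real.exp (-(2 * ‖x‖)) ≤ smoothExp θ x := by
  rw [← Real.exp_add]
  exact Real.exp_le_exp.2 (by linarith [softNorm_le hθ.le x])

theorem integrable_smoothExp {θ : ℝ} (hθ : 0 < θ) : Integrable (smoothExp θ) :=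
  integrable_exp_neg_two_mul_norm.mono' (contDiff_smoothExp hθ).continuous.aestronglyMeasurable
    (Eventually.of_forall fun x => by
      rw [Real.norm_of_nonneg (smoothExp_pos θ x).le]
      exact smoothExp_le θ x)

/-- The total mass of `smoothExp θ`. -/
def smoothExpMass (θ : ℝ) : ℝ := ∫ x, smoothExp θ x

theorem smoothExpMass_pos {θ : ℝ} (hθ : 0 < θ) : 0 < smoothExpMass θ :=
  integral_exp_pos (integrable_smoothExp hθ)

/-- The probability density proportional to `smoothExp θ`. -/
def kernel (θ : ℝ) (x : R3) : ℝ := smoothExp θ x / smoothExpMass θ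

theorem kernel_pos {θ : ℝ} (hθ : 0 < θ) (x : R3) : 0 < kernel θ x :=
  div_pos (smoothExp_pos θ x) (smoothExpMass_pos hθ)

theorem contDiff_kernel {θ : ℝ} (hθ : 0 < θ) : ContDiff ℝ ∞ (kernel θ) :=
  (contDiff_smoothExp hθ).div_const _

theorem integrable_kernel {θ : ℝ} (hθ : 0 < θ) : Integrable (kernel θ) :=
  (integrable_smoothExp hθ).div_const _

theorem integral_kernel {θ : ℝ} (hθ : 0 < θ) : ∫ x, kernel θ x = 1 := by
  simp only [kernel, integral_div]
  exact div_self (smoothExpMass_pos hθ).ne'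

/-- The soft norm has gradient of length at most 1, so the logarithmic derivative is at most 2. This
makes the kinetic energy of the kernel at most 1. -/
theorem norm_fderiv_kernel_le {θ : ℝ} (hθ : 0 < θ) (x : R3) :
    ‖fderiv ℝ (kernel θ) x‖ ≤ 2 * kernel θ x := by
  have h : HasFDerivAt (kernel θ)
      ((smoothExpMass θ)⁻¹ • (smoothExp θ x • -((2 : ℝ) • ((softNorm θ x)⁻¹ • innerSL ℝ x)))) x := by
    unfold kernel
    simp only [div_eq_inv_mul]
    exact (((hasFDerivAt_softNorm hθ x).const_mul 2).fun_neg.exp).const_mul _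
  have hs := softNorm_pos hθ x
  have hI := smoothExpMass_pos hθ
  have hE := smoothExp_pos θ x
  rw [h.fderiv]
  simp only [norm_smul, norm_neg]
  rw [innerSL_apply_norm,
    Real.norm_of_nonneg (inv_pos.2 hI).le, Real.norm_of_nonneg hE.le,
    Real.norm_of_nonneg (inv_pos.2 hs).le, Real.norm_ofNat, kernel]
  have h1 : (softNorm θ x)⁻¹ * ‖x‖ ≤ 1 := by
    rw [inv_mul_le_iff₀ hs, mul_one]
    exact norm_le_softNorm θ x
  calc _ ≤ (smoothExpMass θ)⁻¹ * (smoothExp θ x * (2 * 1)) := by gcongr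
    _ = _ := by ring

/-- Smoothing lowers the normalising mass, which only helps, and lowers the exponential by at most
the factor `exp (-2 θ)`, which tends to 1 with `θ → 0`. -/
theorem le_lintegral_kernel_div {θ : ℝ} (hθ : 0 < θ) :
    ENNReal.ofReal (Real.exp (-(2 * θ))) ≤ ∫⁻ x, ENNReal.ofReal (kernel θ x) / ‖x‖ₑ := by
  have hI := smoothExpMass_pos hθ
  have hle : smoothExpMass θ ≤ ∫ x : R3, Real.exp (-(2 * ‖x‖)) / ‖x‖ := by
    rw [integral_exp_neg_two_mul_norm_div, ← integral_exp_neg_two_mul_norm]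
    exact integral_mono (integrable_smoothExp hθ) integrable_exp_neg_two_mul_norm (smoothExp_le θ)
  set I := smoothExpMass θ with hIdef
  have h1 : Real.exp (-(2 * θ)) ≤
      ∫ x : R3, Real.exp (-(2 * θ)) / I * (Real.exp (-(2 * ‖x‖)) / ‖x‖) := by
    rw [integral_const_mul]
    calc Real.exp (-(2 * θ)) = Real.exp (-(2 * θ)) / I * I := by field_simp
      _ ≤ _ := by gcongr
  refine (ENNReal.ofReal_le_ofReal h1).trans ?_
  rw [ofReal_integral_eq_lintegral_ofReal (integrable_exp_neg_two_mul_norm_div.const_mul _)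
    (Eventually.of_forall fun x => by positivity)]
  refine lintegral_mono_ae ?_
  have hne : ∀ᵐ x : R3, x ≠ 0 := by
    rw [ae_iff]; simp
  filter_upwards [hne] with x hx
  have hx' : 0 < ‖x‖ := norm_pos_iff.2 hx
  rw [← ofReal_norm, ← ENNReal.ofReal_div_of_pos hx']
  refine ENNReal.ofReal_le_ofReal ?_
  calc _ = Real.exp (-(2 * θ)) * Real.exp (-(2 * ‖x‖)) / I / ‖x‖ := by ring
    _ ≤ smoothExp θ x / I / ‖x‖ := by
      have := le_smoothExp hθ x
      gcongr

/-- The density `kernel θ` concentrated at `p` at scale `1 / a`. -/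
def profile (θ : ℝ) (p : R3) (a : ℝ) (x : R3) : ℝ := a ^ 3 * kernel θ (a • (x - p))

theorem profile_pos {θ a : ℝ} (hθ : 0 < θ) (ha : 0 < a) (p x : R3) : 0 < profile θ p a x :=
  mul_pos (by positivity) (kernel_pos hθ _)

theorem contDiff_profile {θ : ℝ} (hθ : 0 < θ) (p : R3) (a : ℝ) :
    ContDiff ℝ ∞ (profile θ p a) :=
  contDiff_const.mul ((contDiff_kernel hθ).comp (by fun_prop))

theorem norm_fderiv_profile_le {θ a : ℝ} (hθ : 0 < θ) (ha : 0 < a) (p x : R3) :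
    ‖fderiv ℝ (profile θ p a) x‖ ≤ 2 * a * profile θ p a x := by
  have d1 : HasFDerivAt (fun x : R3 => a • (x - p)) (a • ContinuousLinearMap.id ℝ R3) x :=
    ((hasFDerivAt_id x).sub_const p).const_smul a
  have d2 := ((contDiff_kernel hθ).differentiable (by simp) (a • (x - p))).hasFDerivAt
  have d3 : HasFDerivAt (profile θ p a) _ x := (d2.comp x d1).const_mul (a ^ 3)
  rw [d3.fderiv, ContinuousLinearMap.comp_smul, ContinuousLinearMap.comp_id, norm_smul, norm_smul,
    Real.norm_of_nonneg ha.le, Real.norm_of_nonneg (by positivity), profile]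
  have := norm_fderiv_kernel_le hθ (a • (x - p))
  calc _ ≤ a ^ 3 * (a * (2 * kernel θ (a • (x - p)))) := by gcongr
    _ = _ := by ring

theorem lintegral_profile_mul {θ a : ℝ} (hθ : 0 < θ) (ha : 0 < a) (p : R3) {f : R3 → ℝ≥0∞}
    (hf : Measurable f) :
    ∫⁻ x, ENNReal.ofReal (profile θ p a x) * f x =
      ∫⁻ y, ENNReal.ofReal (kernel θ y) * f (p + a⁻¹ • y) := by
  let G : R3 → ℝ≥0∞ := fun y => ENNReal.ofReal (a ^ 3 * kernel θ y) * f (p + a⁻¹ • y)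
  have hk : Measurable (kernel θ) := (contDiff_kernel hθ).continuous.measurable
  have hG : Measurable G := by fun_prop
  have h1 : ∀ x, ENNReal.ofReal (profile θ p a x) * f x = G (a • (x - p)) := by
    intro x
    simp [G, profile, smul_smul, ha.ne']
  simp only [h1]
  rw [lintegral_sub_right_eq_self (fun x => G (a • x)) p,
    ← lintegral_map (f := G) hG (by fun_prop : Measurable fun x : R3 => a • x),
    Measure.map_addHaar_smul volume ha.ne', lintegral_smul_measure, smul_eq_mul]
  rw [← lintegral_const_mul _ hG]
  refine lintegral_congr fun y => ?_
  simp only [G, finrank_euclideanSpace, Fintype.card_fin]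
  rw [← mul_assoc, ← ENNReal.ofReal_mul (abs_nonneg _), abs_of_pos (by positivity),
    inv_mul_cancel_left₀ (by positivity)]

theorem integral_profile_mul (θ : ℝ) {a : ℝ} (ha : 0 < a) (p : R3) (f : R3 → ℝ) :
    ∫ x, profile θ p a x * f x = ∫ y, kernel θ y * f (p + a⁻¹ • y) := by
  let G : R3 → ℝ := fun y => a ^ 3 * (kernel θ y * f (p + a⁻¹ • y))
  have h1 : ∀ x, profile θ p a x * f x = G (a • (x - p)) := by
    intro x
    simp [G, profile, smul_smul, ha.ne', mul_assoc]
  simp only [h1]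
  rw [integral_sub_right_eq_self (fun x => G (a • x)) p,
    Measure.integral_comp_smul_of_nonneg volume G a (hR := ha.le), smul_eq_mul,
    integral_const_mul, finrank_euclideanSpace, Fintype.card_fin,
    inv_mul_cancel_left₀ (by positivity)]

theorem lintegral_profile {θ a : ℝ} (hθ : 0 < θ) (ha : 0 < a) (p : R3) :
    ∫⁻ x, ENNReal.ofReal (profile θ p a x) = 1 := by
  have h := lintegral_profile_mul hθ ha p (f := fun _ => 1) measurable_const
  simp only [mul_one] at h
  rw [h, ← ofReal_integral_eq_lintegral_ofReal (integrable_kernel hθ)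
    (Eventually.of_forall fun x => (kernel_pos hθ x).le), integral_kernel hθ, ENNReal.ofReal_one]

theorem integrable_profile {θ a : ℝ} (hθ : 0 < θ) (ha : 0 < a) (p : R3) :
    Integrable (profile θ p a) := by
  refine ⟨(contDiff_profile hθ p a).continuous.aestronglyMeasurable, ?_⟩
  rw [hasFiniteIntegral_iff_ofReal (Eventually.of_forall fun x => (profile_pos hθ ha p x).le),
    lintegral_profile hθ ha p]
  exact ENNReal.one_lt_top

theorem le_lintegral_profile_div {θ a : ℝ} (hθ : 0 < θ) (ha : 0 < a) (p : R3) :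
    ENNReal.ofReal (a * Real.exp (-(2 * θ))) ≤
      ∫⁻ x, ENNReal.ofReal (profile θ p a x) * ‖x - p‖ₑ⁻¹ := by
  rw [lintegral_profile_mul hθ ha p (by fun_prop), ENNReal.ofReal_mul ha.le]
  refine (mul_le_mul_right (le_lintegral_kernel_div hθ) _).trans ?_
  rw [← lintegral_const_mul' _ _ ENNReal.ofReal_ne_top]
  refine lintegral_mono fun y => ?_
  simp only [add_sub_cancel_left, enorm_smul, div_eq_mul_inv]
  have h : ‖(a⁻¹ : ℝ)‖ₑ = (ENNReal.ofReal a)⁻¹ := by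
    rw [Real.enorm_of_nonneg (by positivity), ENNReal.ofReal_inv_of_pos ha]
  have ha' : ENNReal.ofReal a ≠ 0 := by simpa using ha
  rw [h, ENNReal.mul_inv (by simp) (by simp [ha']), inv_inv]
  refine le_of_eq ?_
  ring

theorem tendsto_integral_profile {θ : ℝ} (hθ : 0 < θ) (p : R3) (f : C₀(R3, ℝ)) :
    Tendsto (fun a => ∫ x, profile θ p a x * f x) atTop (𝓝 (f p)) := by
  have h : Tendsto (fun a : ℝ => ∫ y, kernel θ y * f (p + a⁻¹ • y)) atTop
      (𝓝 (∫ y, kernel θ y * f p)) := by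
    refine tendsto_integral_filter_of_dominated_convergence (fun y => kernel θ y * ‖f.toBCF‖) ?_ ?_
      ((integrable_kernel hθ).mul_const _) ?_
    · refine Eventually.of_forall fun a => Continuous.aestronglyMeasurable ?_
      exact (contDiff_kernel hθ).continuous.mul (f.continuous.comp (by fun_prop))
    · refine Eventually.of_forall fun a => Eventually.of_forall fun y => ?_
      rw [norm_mul, Real.norm_of_nonneg (kernel_pos hθ y).le]
      have := (kernel_pos hθ y).le
      gcongr
      exact f.toBCF.norm_coe_le_norm _
    · refine Eventually.of_forall fun y => Tendsto.const_mul _ ?_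
      have : Tendsto (fun a : ℝ => p + a⁻¹ • y) atTop (𝓝 p) := by
        simpa using ((tendsto_inv_atTop_zero (𝕜 := ℝ)).smul_const y).const_add p
      exact (f.continuous.tendsto p).comp this
  rw [integral_mul_const, integral_kernel hθ, one_mul] at h
  refine h.congr' ?_
  filter_upwards [eventually_gt_atTop 0] with a ha
  rw [integral_profile_mul θ ha]

/-! ### Superpositions of profiles -/

theorem isWeakGradient_gradient {u : R3 → ℝ} (hu : ContDiff ℝ ∞ u) :
    IsWeakGradient u (gradient u) := by
  have hgc : ∀ {φ : R3 → ℝ}, ContDiff ℝ ∞ φ → Continuous (gradient φ) := fun hφ =>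
    (InnerProductSpace.toDual ℝ R3).symm.continuous.comp (hφ.continuous_fderiv (by simp))
  refine ⟨hu.continuous.locallyIntegrable, (hgc hu).locallyIntegrable, fun φ hφ hc => ?_⟩
  have hcg : HasCompactSupport (gradient φ) :=
    (hc.fderiv ℝ).comp_left (g := (InnerProductSpace.toDual ℝ R3).symm) (map_zero _)
  have i1 := hu.continuous.locallyIntegrable (μ := volume)
    |>.integrable_smul_right_of_hasCompactSupport (hgc hφ) hcg
  have i2 := (hgc hu).locallyIntegrable (μ := volume)
    |>.integrable_smul_left_of_hasCompactSupport hφ.continuous hc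
  refine ext_inner_left ℝ fun v => ?_
  rw [inner_neg_right, ← integral_inner i1, ← integral_inner i2]
  simp only [real_inner_smul_right, inner_gradient_right, conj_trivial]
  rw [integral_mul_fderiv_eq_neg_fderiv_mul_of_integrable]
  · simp only [mul_comm]
  · exact (((hu.continuous_fderiv (by simp)).clm_apply continuous_const).mul
      hφ.continuous).integrable_of_hasCompactSupport hc.mul_left
  · exact (hu.continuous.mul ((hφ.continuous_fderiv (by simp)).clm_apply
      continuous_const)).integrable_of_hasCompactSupport (hc.fderiv_apply ℝ v).mul_left
  · exact (hu.continuous.mul hφ.continuous).integrable_of_hasCompactSupport hc.mul_left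
  · exact fun x _ => hu.differentiable (by simp) x
  · exact fun x _ => hφ.differentiable (by simp) x

theorem IsWeakGradient.congr_left {u v : R3 → ℝ} {g : R3 → R3} (h : IsWeakGradient u g)
    (huv : u =ᵐ[volume] v) : IsWeakGradient v g := by
  refine ⟨h.1.congr huv, h.2.1, fun φ hφ hc => ?_⟩
  rw [← h.2.2 φ hφ hc]
  refine integral_congr_ae ?_
  filter_upwards [huv] with x hx
  rw [hx]

section Superposition

variable {ι : Type*} [Fintype ι]

/-- The density `∑ i, m i * profile θ (p i) (a i)`. -/
def mixture (θ : ℝ) (m : ι → ℝ) (p : ι → R3) (a : ι → ℝ) (x : R3) : ℝ :=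
  ∑ i, m i * profile θ (p i) (a i) x

variable {θ : ℝ} {m : ι → ℝ} {p : ι → R3} {a : ι → ℝ}

theorem mixture_pos (hθ : 0 < θ) (hm : ∀ i, 0 ≤ m i) (hm1 : ∑ i, m i = 1) (ha : ∀ i, 0 < a i)
    (x : R3) : 0 < mixture θ m p a x := by
  obtain ⟨i, hi⟩ : ∃ i, m i ≠ 0 := by
    by_contra! h
    simp [h] at hm1
  exact Finset.sum_pos' (fun j _ => mul_nonneg (hm j) (profile_pos hθ (ha j) _ _).le)
    ⟨i, Finset.mem_univ i, mul_pos ((hm i).lt_of_ne' hi) (profile_pos hθ (ha i) _ _)⟩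

theorem contDiff_mixture (hθ : 0 < θ) : ContDiff ℝ ∞ (mixture θ m p a) :=
  ContDiff.sum fun i _ => contDiff_const.mul (contDiff_profile hθ (p i) (a i))

theorem lintegral_mixture_mul (hθ : 0 < θ) (hm : ∀ i, 0 ≤ m i) (ha : ∀ i, 0 < a i)
    {f : R3 → ℝ≥0∞} (hf : Measurable f) :
    ∫⁻ x, ENNReal.ofReal (mixture θ m p a x) * f x =
      ∑ i, ENNReal.ofReal (m i) * ∫⁻ x, ENNReal.ofReal (profile θ (p i) (a i) x) * f x := by
  have hk : ∀ i, Measurable (profile θ (p i) (a i)) := fun i =>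
    (contDiff_profile hθ (p i) (a i)).continuous.measurable
  have h1 : ∀ x, ENNReal.ofReal (mixture θ m p a x) * f x =
      ∑ i, ENNReal.ofReal (m i) * (ENNReal.ofReal (profile θ (p i) (a i) x) * f x) := by
    intro x
    rw [mixture, ENNReal.ofReal_sum_of_nonneg fun i _ =>
      mul_nonneg (hm i) (profile_pos hθ (ha i) _ _).le, Finset.sum_mul]
    refine Finset.sum_congr rfl fun i _ => ?_
    rw [ENNReal.ofReal_mul (hm i), mul_assoc]
  simp only [h1]
  rw [lintegral_finsetSum _ fun i _ => by fun_prop]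
  exact Finset.sum_congr rfl fun i _ => lintegral_const_mul' _ _ ENNReal.ofReal_ne_top

theorem lintegral_mixture (hθ : 0 < θ) (hm : ∀ i, 0 ≤ m i) (hm1 : ∑ i, m i = 1)
    (ha : ∀ i, 0 < a i) : ∫⁻ x, ENNReal.ofReal (mixture θ m p a x) = 1 := by
  have h := lintegral_mixture_mul (p := p) hθ hm ha (f := fun _ => 1) measurable_const
  simp only [mul_one] at h
  rw [h]
  simp only [lintegral_profile hθ (ha _), mul_one]
  rw [← ENNReal.ofReal_sum_of_nonneg fun i _ => hm i, hm1, ENNReal.ofReal_one]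

/-- The probability measure with density `mixture θ m p a`. -/
def mixtureProb (hθ : 0 < θ) (hm : ∀ i, 0 ≤ m i) (hm1 : ∑ i, m i = 1) (ha : ∀ i, 0 < a i)
    (p : ι → R3) : SubProb :=
  ⟨volume.withDensity fun x => ENNReal.ofReal (mixture θ m p a x), by
    rw [withDensity_apply _ MeasurableSet.univ, setLIntegral_univ, lintegral_mixture hθ hm hm1 ha]⟩

theorem measurable_ofReal_mixture (hθ : 0 < θ) :
    Measurable fun x => ENNReal.ofReal (mixture θ m p a x) :=
  (contDiff_mixture hθ).continuous.measurable.ennreal_ofReal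

theorem integral_mixtureProb (hθ : 0 < θ) (hm : ∀ i, 0 ≤ m i) (hm1 : ∑ i, m i = 1)
    (ha : ∀ i, 0 < a i) (f : C₀(R3, ℝ)) :
    ∫ x, f x ∂(mixtureProb hθ hm hm1 ha p).toMeasure =
      ∑ i, m i * ∫ x, profile θ (p i) (a i) x * f x := by
  change ∫ x, f x ∂(volume.withDensity fun x => ENNReal.ofReal (mixture θ m p a x)) = _
  rw [integral_withDensity_eq_integral_toReal_smul (measurable_ofReal_mixture hθ)
    (Eventually.of_forall fun x => ENNReal.ofReal_lt_top)]
  have h1 : ∀ x, (ENNReal.ofReal (mixture θ m p a x)).toReal • f x =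
      ∑ i, m i * (profile θ (p i) (a i) x * f x) := by
    intro x
    rw [ENNReal.toReal_ofReal (mixture_pos hθ hm hm1 ha x).le, mixture, smul_eq_mul,
      Finset.sum_mul]
    exact Finset.sum_congr rfl fun i _ => mul_assoc _ _ _
  simp only [h1]
  rw [integral_finsetSum]
  · exact Finset.sum_congr rfl fun i _ => integral_const_mul _ _
  · intro i _
    refine Integrable.const_mul ?_ _
    exact (integrable_profile hθ (ha i) (p i)).mul_bdd (c := ‖f.toBCF‖)
      f.continuous.aestronglyMeasurable (Eventually.of_forall fun x => f.toBCF.norm_coe_le_norm x)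

/-- With `D` the mixture, `|∇√D|² = |∇D|² / (4 D)` and `|∇D| ≤ 2 ∑ m a q` for the profiles `q`.
Cauchy–Schwarz bounds `(∑ m a q)²` by `D ∑ m a² q`, and `D` cancels. -/
theorem norm_gradient_sqrt_mixture_sq_le (hθ : 0 < θ) (hm : ∀ i, 0 ≤ m i) (hm1 : ∑ i, m i = 1)
    (ha : ∀ i, 0 < a i) (x : R3) :
    ‖gradient (fun x => √(mixture θ m p a x)) x‖ ^ 2 ≤
      mixture θ (fun i => m i * a i ^ 2) p a x := by
  have hD := mixture_pos (p := p) hθ hm hm1 ha x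
  have hq : ∀ i, 0 ≤ profile θ (p i) (a i) x := fun i => (profile_pos hθ (ha i) _ _).le
  have d1 : HasFDerivAt (mixture θ m p a) (∑ i, m i • fderiv ℝ (profile θ (p i) (a i)) x) x :=
    HasFDerivAt.fun_sum fun i _ =>
      ((contDiff_profile hθ (p i) (a i)).differentiable (by simp) x).hasFDerivAt.const_mul (m i)
  have hn : ‖∑ i, m i • fderiv ℝ (profile θ (p i) (a i)) x‖ ≤
      2 * ∑ i, m i * a i * profile θ (p i) (a i) x := by
    refine (norm_sum_le _ _).trans ?_
    rw [Finset.mul_sum]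
    refine Finset.sum_le_sum fun i _ => ?_
    rw [norm_smul, Real.norm_of_nonneg (hm i)]
    have := norm_fderiv_profile_le hθ (ha i) (p i) x
    have := mul_le_mul_of_nonneg_left this (hm i)
    linarith
  have hcs : (∑ i, m i * a i * profile θ (p i) (a i) x) ^ 2 ≤
      mixture θ m p a x * mixture θ (fun i => m i * a i ^ 2) p a x := by
    refine Finset.sum_sq_le_sum_mul_sum_of_sq_le_mul _ (fun i _ => mul_nonneg (hm i) (hq i))
      (fun i _ => mul_nonneg (mul_nonneg (hm i) (sq_nonneg _)) (hq i)) fun i _ => le_of_eq ?_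
    ring
  have d2 := d1.sqrt hD.ne'
  rw [gradient, LinearIsometryEquiv.norm_map, d2.fderiv, norm_smul,
    Real.norm_of_nonneg (by positivity), mul_pow, div_pow, mul_pow, Real.sq_sqrt hD.le]
  calc _ ≤ 1 ^ 2 / (2 ^ 2 * mixture θ m p a x) *
        (2 * ∑ i, m i * a i * profile θ (p i) (a i) x) ^ 2 := by gcongr
    _ = (∑ i, m i * a i * profile θ (p i) (a i) x) ^ 2 / mixture θ m p a x := by
      field_simp
    _ ≤ _ := by
      rw [div_le_iff₀ hD]
      linarith

theorem lintegral_gradient_sqrt_mixture_le (hθ : 0 < θ) (hm : ∀ i, 0 ≤ m i)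
    (hm1 : ∑ i, m i = 1) (ha : ∀ i, 0 < a i) :
    ∫⁻ x, ‖gradient (fun x => √(mixture θ m p a x)) x‖ₑ ^ 2 ≤
      ENNReal.ofReal (∑ i, m i * a i ^ 2) := by
  have hm' : ∀ i, 0 ≤ m i * a i ^ 2 := fun i => mul_nonneg (hm i) (sq_nonneg _)
  have h := lintegral_mixture_mul (p := p) hθ hm' ha (f := fun _ => 1) measurable_const
  simp only [mul_one, lintegral_profile hθ (ha _)] at h
  rw [ENNReal.ofReal_sum_of_nonneg fun i _ => hm' i, ← h]
  refine lintegral_mono fun x => ?_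
  rw [← ofReal_norm, ← ENNReal.ofReal_pow (norm_nonneg _)]
  exact ENNReal.ofReal_le_ofReal (norm_gradient_sqrt_mixture_sq_le hθ hm hm1 ha x)

theorem sqrtDensity_mixtureProb (hθ : 0 < θ) (hm : ∀ i, 0 ≤ m i) (hm1 : ∑ i, m i = 1)
    (ha : ∀ i, 0 < a i) :
    (fun x => √(mixture θ m p a x)) =ᵐ[volume]
      sqrtDensity (mixtureProb hθ hm hm1 ha p).toMeasure := by
  filter_upwards [Measure.rnDeriv_withDensity volume
    (measurable_ofReal_mixture (m := m) (p := p) (a := a) hθ)] with x hx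
  change _ = √(((volume.withDensity fun x =>
    ENNReal.ofReal (mixture θ m p a x)).rnDeriv volume x).toReal)
  rw [hx, ENNReal.toReal_ofReal (mixture_pos hθ hm hm1 ha x).le]

theorem contDiff_sqrt_mixture (hθ : 0 < θ) (hm : ∀ i, 0 ≤ m i) (hm1 : ∑ i, m i = 1)
    (ha : ∀ i, 0 < a i) : ContDiff ℝ ∞ fun x => √(mixture θ m p a x) :=
  (contDiff_mixture hθ).sqrt fun x => (mixture_pos hθ hm hm1 ha x).ne'

theorem isWeakGradient_mixtureProb (hθ : 0 < θ) (hm : ∀ i, 0 ≤ m i) (hm1 : ∑ i, m i = 1)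
    (ha : ∀ i, 0 < a i) :
    IsWeakGradient (sqrtDensity (mixtureProb hθ hm hm1 ha p).toMeasure)
      (gradient fun x => √(mixture θ m p a x)) :=
  (isWeakGradient_gradient (contDiff_sqrt_mixture hθ hm hm1 ha)).congr_left
    (sqrtDensity_mixtureProb hθ hm hm1 ha)

theorem kinetic_mixtureProb_le (hθ : 0 < θ) (hm : ∀ i, 0 ≤ m i) (hm1 : ∑ i, m i = 1)
    (ha : ∀ i, 0 < a i) :
    kinetic (mixtureProb hθ hm hm1 ha p).toMeasure ≤ ENNReal.ofReal (∑ i, m i * a i ^ 2) :=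
  (iInf₂_le _ (isWeakGradient_mixtureProb hθ hm hm1 ha)).trans
    (lintegral_gradient_sqrt_mixture_le hθ hm hm1 ha)

theorem mixtureProb_mem_admissible (hθ : 0 < θ) (hm : ∀ i, 0 ≤ m i) (hm1 : ∑ i, m i = 1)
    (ha : ∀ i, 0 < a i) : mixtureProb hθ hm hm1 ha p ∈ admissible := by
  have hw := isWeakGradient_mixtureProb (p := p) hθ hm hm1 ha
  refine ⟨?_, withDensity_absolutelyContinuous _ _, ?_, _, ?_, hw⟩
  · change (volume.withDensity fun x => ENNReal.ofReal (mixture θ m p a x)) Set.univ = 1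
    rw [withDensity_apply _ MeasurableSet.univ, setLIntegral_univ, lintegral_mixture hθ hm hm1 ha]
  · refine MemLp.ae_eq (sqrtDensity_mixtureProb hθ hm hm1 ha) (memLp_two_of_lintegral_lt_top
      (contDiff_sqrt_mixture hθ hm hm1 ha).continuous.aestronglyMeasurable ?_)
    have : ∀ x, ‖√(mixture θ m p a x)‖ₑ ^ 2 = ENNReal.ofReal (mixture θ m p a x) := fun x => by
      rw [← ofReal_norm, ← ENNReal.ofReal_pow (norm_nonneg _), Real.norm_eq_abs, sq_abs,
        Real.sq_sqrt (mixture_pos hθ hm hm1 ha x).le]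
    simp only [this]
    rw [lintegral_mixture hθ hm hm1 ha]
    exact ENNReal.one_lt_top
  · exact memLp_two_of_lintegral_lt_top hw.2.1.aestronglyMeasurable
      ((lintegral_gradient_sqrt_mixture_le hθ hm hm1 ha).trans_lt ENNReal.ofReal_lt_top)

/-- Only the component centred at `p i` is kept; the others contribute nonnegatively. -/
theorem le_lintegral_mixtureProb_inv (hθ : 0 < θ) (hm : ∀ i, 0 ≤ m i) (hm1 : ∑ i, m i = 1)
    (ha : ∀ i, 0 < a i) (i : ι) :
    ENNReal.ofReal (m i * (a i * Real.exp (-(2 * θ)))) ≤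
      ∫⁻ x, ‖x - p i‖ₑ⁻¹ ∂(mixtureProb hθ hm hm1 ha p).toMeasure := by
  change _ ≤ ∫⁻ x, ‖x - p i‖ₑ⁻¹ ∂(volume.withDensity fun x => ENNReal.ofReal (mixture θ m p a x))
  rw [lintegral_withDensity_eq_lintegral_mul _ (measurable_ofReal_mixture hθ) (by fun_prop)]
  simp only [Pi.mul_apply]
  rw [lintegral_mixture_mul hθ hm ha (by fun_prop), ENNReal.ofReal_mul (hm i)]
  refine le_trans ?_ (Finset.single_le_sum (f := fun j => ENNReal.ofReal (m j) *
    ∫⁻ x, ENNReal.ofReal (profile θ (p j) (a j) x) * ‖x - p i‖ₑ⁻¹) (fun _ _ => zero_le)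
    (Finset.mem_univ i))
  exact mul_le_mul_right (le_lintegral_profile_div hθ (ha i) (p i)) _

end Superposition

theorem coe_sub_le {a b : ℝ≥0∞} {A B : ℝ} (hA : 0 ≤ A) (hB : 0 ≤ B) (ha : a ≤ ENNReal.ofReal A)
    (hb : ENNReal.ofReal B ≤ b) : (a : EReal) - (b : EReal) ≤ ((A - B : ℝ) : EReal) := by
  rw [EReal.coe_sub]
  refine EReal.sub_le_sub ?_ ?_
  · have := EReal.coe_ennreal_le_coe_ennreal_iff.2 ha
    rwa [EReal.coe_ennreal_ofReal, max_eq_left hA] at this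
  · have := EReal.coe_ennreal_le_coe_ennreal_iff.2 hb
    rwa [EReal.coe_ennreal_ofReal, max_eq_left hB] at this

/-- The energy of a mixture of profiles, some of which are centred at the nuclei. -/
theorem energy_mixtureProb_le {M : ℕ} {Z : Fin M → ℝ} (hZ : ∀ k, 0 < Z k) {X : Fin M → R3}
    {J : Type*} [Fintype J] {θ : ℝ} {m : Fin M ⊕ J → ℝ} {a : Fin M ⊕ J → ℝ}
    (hθ : 0 < θ) (hm : ∀ i, 0 ≤ m i) (hm1 : ∑ i, m i = 1) (ha : ∀ i, 0 < a i)
    (y : J → R3) {ε : ℝ} (hε : 0 < ε) :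
    energy Z X ε (mixtureProb hθ hm hm1 ha (Sum.elim X y)) ≤
      ((ε ^ 2 * ∑ i, m i * a i ^ 2 -
        ε * ∑ k, Z k * (m (.inl k) * (a (.inl k) * Real.exp (-(2 * θ)))) : ℝ) : EReal) := by
  rw [energy, if_pos (mixtureProb_mem_admissible hθ hm hm1 ha)]
  have hT : ∀ k, 0 ≤ Z k * (m (.inl k) * (a (.inl k) * Real.exp (-(2 * θ)))) := fun k => by
    have := (hZ k).le
    have := hm (.inl k)
    have := (ha (.inl k)).le
    positivity
  refine coe_sub_le (mul_nonneg (sq_nonneg _) (Finset.sum_nonneg fun i _ =>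
    mul_nonneg (hm i) (sq_nonneg _))) (mul_nonneg hε.le (Finset.sum_nonneg fun k _ => hT k)) ?_ ?_
  · rw [ENNReal.ofReal_mul (sq_nonneg _)]
    gcongr
    exact kinetic_mixtureProb_le hθ hm hm1 ha
  · rw [ENNReal.ofReal_mul hε.le]
    gcongr
    unfold potential
    rw [lintegral_finsetSum _ fun k _ => by fun_prop, ENNReal.ofReal_sum_of_nonneg fun k _ => hT k]
    refine Finset.sum_le_sum fun k _ => ?_
    simp only [div_eq_mul_inv]
    rw [lintegral_const_mul' _ _ ENNReal.ofReal_ne_top, ENNReal.ofReal_mul (hZ k).le]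
    gcongr
    exact le_lintegral_mixtureProb_inv (p := Sum.elim X y) hθ hm hm1 ha (.inl k)

/-! ### The upper bound -/

theorem exists_finset_of_mem_nhds {ρ : SubProb} {U : Set SubProb} (hU : U ∈ 𝓝 ρ) :
    ∃ S : Finset C₀(R3, ℝ), ∃ η > 0, ∀ σ : SubProb,
      (∀ f ∈ S, |∫ x, f x ∂σ.toMeasure - ∫ x, f x ∂ρ.toMeasure| < η) → σ ∈ U := by
  rw [nhds_induced, nhds_pi] at hU
  obtain ⟨V, hV, hVU⟩ := hU
  obtain ⟨I, hI, t, ht, htV⟩ := Filter.mem_pi.1 hV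
  have h : ∀ f : C₀(R3, ℝ), ∃ η > 0, ∀ r : ℝ, |r - ∫ x, f x ∂ρ.toMeasure| < η → r ∈ t f := by
    intro f
    obtain ⟨η, hη, h⟩ := Metric.mem_nhds_iff.1 (ht f)
    exact ⟨η, hη, fun r hr => h (by rwa [Metric.mem_ball, Real.dist_eq])⟩
  choose η hη h using h
  obtain ⟨η₀, hη₀, hle⟩ : ∃ η₀ > 0, ∀ f ∈ hI.toFinset, η₀ ≤ η f := by
    rcases hI.toFinset.eq_empty_or_nonempty with he | hne
    · exact ⟨1, one_pos, by simp [he]⟩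
    · exact ⟨hI.toFinset.inf' hne η, (Finset.lt_inf'_iff hne).2 fun f _ => hη f,
        fun f hf => Finset.inf'_le η hf⟩
  refine ⟨hI.toFinset, η₀, hη₀, fun σ hσ => hVU (htV fun f hf => ?_)⟩
  have hf' : f ∈ hI.toFinset := hI.mem_toFinset.2 hf
  exact h f _ ((hσ f hf').trans_le (hle f hf'))

theorem integrable_zeroAtInfty (μ : Measure R3) [IsFiniteMeasure μ] (f : C₀(R3, ℝ)) :
    Integrable f μ :=
  f.toBCF.integrable μ

/-- Weak* approximation of a finite measure of mass at most `r` by finitely supported measures of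
mass `r`. -/
theorem exists_discrete_approximation (μ : Measure R3) [IsFiniteMeasure μ] {r : ℝ}
    (hμ : μ.real Set.univ ≤ r) (hr : r ≤ 1) (S : Finset C₀(R3, ℝ)) {η : ℝ} (hη : 0 < η) :
    ∃ (J : Type) (_ : Fintype J) (w : J → ℝ) (y : J → R3), (∀ j, 0 ≤ w j) ∧ ∑ j, w j = r ∧
      ∀ f ∈ S, |∑ j, w j * f (y j) - ∫ x, f x ∂μ| < η := by
  have hr0 : 0 ≤ r := measureReal_nonneg.trans hμ
  let F : R3 → S → ℝ := fun x f => f.1 x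
  -- Only the vector of integrals against `S` matters, and convex combinations of the vectors `F x`
  -- are those given by discrete probabilities.
  let K : Set (S → ℝ) := closure (convexHull ℝ (Set.range F))
  have hKc : IsClosed K := isClosed_closure
  have hKconv : Convex ℝ K := (convex_convexHull ℝ _).closure
  have hFK : ∀ x, F x ∈ K := fun x => subset_closure (subset_convexHull ℝ _ ⟨x, rfl⟩)
  -- Test functions vanish at infinity, so a point sent far away represents the zero vector. This is
  -- how mass missing from `μ` is supplied.
  have h0 : (0 : S → ℝ) ∈ K := by
    refine hKc.mem_of_tendsto (b := Filter.cocompact R3) (f := F) ?_ (Eventually.of_forall hFK)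
    exact tendsto_pi_nhds.2 fun f => f.1.zero_at_infty'
  have hFi : Integrable F μ := Integrable.of_eval fun f => integrable_zeroAtInfty μ f.1
  obtain ⟨v, hvK, hv⟩ : ∃ v ∈ K, r • v = ∫ x, F x ∂μ := by
    rcases eq_or_ne μ 0 with rfl | hne
    · exact ⟨0, h0, by simp⟩
    · have : NeZero μ := ⟨hne⟩
      have hpos : 0 < μ.real Set.univ := measureReal_univ_pos
      have hrpos : 0 < r := hpos.trans_le hμ
      have hav := hKconv.average_mem hKc (Eventually.of_forall hFK) hFi
      -- The mean of `F` is moved towards `0 ∈ K` so that total mass `r` reproduces the integral.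
      refine ⟨(μ.real Set.univ / r) • (⨍ x, F x ∂μ), ?_, ?_⟩
      · have := hKconv hav h0 (a := μ.real Set.univ / r) (b := 1 - μ.real Set.univ / r)
          (by positivity) (by rw [sub_nonneg, div_le_one hrpos]; exact hμ) (by ring)
        simpa using this
      · rw [smul_smul, mul_div_cancel₀ _ hrpos.ne', measure_smul_average]
  obtain ⟨v', hv', hd⟩ := Metric.mem_closure_iff.1 hvK η hη
  obtain ⟨J, hJ, w, z, hw, hw1, hz, hsum⟩ := mem_convexHull_iff_exists_fintype.1 hv'
  choose y hy using hz
  refine ⟨J, hJ, fun j => r * w j, y, fun j => mul_nonneg hr0 (hw j), ?_, fun f hf => ?_⟩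
  · rw [← Finset.mul_sum, hw1, mul_one]
  · have e1 : ∑ j, r * w j * f (y j) = r * v' ⟨f, hf⟩ := by
      rw [← hsum, Finset.sum_apply, Finset.mul_sum]
      refine Finset.sum_congr rfl fun j _ => ?_
      rw [← hy j, Pi.smul_apply, smul_eq_mul, mul_assoc]
    have e2 : ∫ x, f x ∂μ = r * v ⟨f, hf⟩ := by
      have := congrFun hv ⟨f, hf⟩
      rw [eval_integral (f := F) fun f => integrable_zeroAtInfty μ f.1] at this
      exact this.symm
    rw [e1, e2, ← mul_sub, abs_mul, abs_of_nonneg hr0]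
    have h1 : |v' ⟨f, hf⟩ - v ⟨f, hf⟩| < η := by
      rw [← Real.dist_eq, dist_comm]
      exact (dist_le_pi_dist v v' ⟨f, hf⟩).trans_lt hd
    nlinarith [abs_nonneg (v' ⟨f, hf⟩ - v ⟨f, hf⟩)]

theorem gammaLimsup_le_limitEnergy {M : ℕ} {Z : Fin M → ℝ} (hZ : ∀ k, 0 < Z k)
    {X : Fin M → R3} (hX : Function.Injective X) (ρ : SubProb) :
    gammaLimsup (𝓝[>] (0 : ℝ)) (energy Z X) ρ ≤ limitEnergy Z X ρ := by
  refine iSup₂_le fun U hU => EReal.le_of_forall_lt_iff_le.1 fun c hc => ?_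
  rw [limitEnergy, EReal.coe_lt_coe_iff] at hc
  obtain ⟨S, η, hη, hS⟩ := exists_finset_of_mem_nhds hU
  let mX : Fin M → ℝ := fun k => ρ.toMeasure.real {X k}
  -- At `a = Z / (2 ε)` the energy per unit mass is `ε² a² - ε Z a exp (-2 θ) = Z² / 4 * (1 - 2 exp
  -- (-2 θ))`, independent of `ε`.
  have ht : Tendsto (fun θ : ℝ => ∑ k, mX k * (Z k ^ 2 / 4 * (1 - 2 * Real.exp (-(2 * θ)))))
      (𝓝[>] 0) (𝓝 (-(1 / 4) * ∑ k, Z k ^ 2 * (ρ.toMeasure {X k}).toReal)) := by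
    have : Continuous fun θ : ℝ =>
        ∑ k, mX k * (Z k ^ 2 / 4 * (1 - 2 * Real.exp (-(2 * θ)))) := by fun_prop
    convert (this.tendsto 0).mono_left nhdsWithin_le_nhds using 2
    simp only [mX, measureReal_def, mul_zero, neg_zero, Real.exp_zero, Finset.mul_sum]
    exact Finset.sum_congr rfl fun k _ => by ring
  obtain ⟨θ, hcθ, hθ⟩ := ((ht.eventually_lt_const hc).and self_mem_nhdsWithin).exists
  let T : Finset R3 := Finset.univ.image X
  have hsumT : ∀ f : R3 → ℝ, ∑ x ∈ T, ρ.toMeasure.real {x} * f x = ∑ k, mX k * f (X k) :=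
    fun f => Finset.sum_image fun i _ j _ h => hX h
  have hsplit : ∀ f : C₀(R3, ℝ), ∫ x, f x ∂ρ.toMeasure =
      ∑ k, mX k * f (X k) + ∫ x in (T : Set R3)ᶜ, f x ∂ρ.toMeasure := by
    intro f
    have hf := integrable_zeroAtInfty ρ.toMeasure f
    rw [← integral_add_compl T.measurableSet hf, setIntegral_finset T hf.integrableOn]
    simp only [smul_eq_mul, hsumT]
  have hmass : (ρ.toMeasure.restrict (T : Set R3)ᶜ).real Set.univ ≤ 1 - ∑ k, mX k := by
    have h1 := measureReal_add_measureReal_compl (μ := ρ.toMeasure) T.measurableSet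
    have h2 : ρ.toMeasure.real (T : Set R3) = ∑ k, mX k := by
      rw [← sum_measureReal_singleton]
      simpa using hsumT fun _ => 1
    have h3 : ρ.toMeasure.real Set.univ ≤ 1 := ENNReal.toReal_le_of_le_ofReal zero_le_one
      (by rw [ENNReal.ofReal_one]; exact ρ.2)
    rw [measureReal_restrict_apply_univ]
    linarith
  have hmX : ∀ k, 0 ≤ mX k := fun k => measureReal_nonneg
  -- The weights sum to `1 - ∑ k, mX k`, not to the mass of `ρ` off the nuclei, because competitors
  -- must be probabilities.
  obtain ⟨J, _, w, y, hw, hw1, hwf⟩ := exists_discrete_approximation _ hmass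
    (by linarith [Finset.sum_nonneg fun k (_ : k ∈ Finset.univ) => hmX k]) S
    (η := η / 3) (by positivity)
  have hA : ∀ᶠ A in atTop, ∀ f ∈ S, |∑ j, w j * (∫ x, profile θ (y j) A x * f x) -
      ∑ j, w j * f (y j)| < η / 3 := by
    refine (Filter.eventually_all_finset S).2 fun f _ => ?_
    have : Tendsto (fun A => ∑ j, w j * (∫ x, profile θ (y j) A x * f x)) atTop
        (𝓝 (∑ j, w j * f (y j))) :=
      tendsto_finsetSum _ fun j _ => (tendsto_integral_profile hθ (y j) f).const_mul (w j)
    simpa only [Real.dist_eq] using Metric.tendsto_nhds.1 this (η / 3) (by positivity)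
  -- `A` is fixed before `ε`, so the kinetic cost `ε² A²` of the diffuse part vanishes in the limit.
  obtain ⟨A, hAf, hA0⟩ := (hA.and (eventually_gt_atTop 0)).exists
  have hεf : ∀ᶠ ε in 𝓝[>] (0 : ℝ), ∀ f ∈ S,
      |∑ k, mX k * (∫ x, profile θ (X k) (Z k / (2 * ε)) x * f x) - ∑ k, mX k * f (X k)| < η / 3 := by
    refine (Filter.eventually_all_finset S).2 fun f _ => ?_
    have : Tendsto (fun ε => ∑ k, mX k * (∫ x, profile θ (X k) (Z k / (2 * ε)) x * f x))
        (𝓝[>] 0) (𝓝 (∑ k, mX k * f (X k))) := by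
      refine tendsto_finsetSum _ fun k _ => Tendsto.const_mul _ ?_
      refine (tendsto_integral_profile hθ (X k) f).comp ?_
      have h := (tendsto_inv_nhdsGT_zero (𝕜 := ℝ)).const_mul_atTop (half_pos (hZ k))
      refine h.congr fun ε => ?_
      rw [div_mul_eq_div_div, div_eq_mul_inv (Z k / 2)]
    simpa only [Real.dist_eq] using Metric.tendsto_nhds.1 this (η / 3) (by positivity)
  have hεc : ∀ᶠ ε in 𝓝[>] (0 : ℝ),
      ∑ k, mX k * (Z k ^ 2 / 4 * (1 - 2 * Real.exp (-(2 * θ)))) + ε ^ 2 * ∑ j, w j * A ^ 2 < c := by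
    have h : Continuous fun ε : ℝ => ∑ k, mX k * (Z k ^ 2 / 4 * (1 - 2 * Real.exp (-(2 * θ)))) +
      ε ^ 2 * ∑ j, w j * A ^ 2 := by fun_prop
    have h' := (h.tendsto 0).mono_left (nhdsWithin_le_nhds (s := Set.Ioi 0))
    rw [zero_pow two_ne_zero, zero_mul, add_zero] at h'
    exact h'.eventually_lt_const hcθ
  refine limsup_le_of_le (by isBoundedDefault) ?_
  filter_upwards [hεf, hεc, self_mem_nhdsWithin] with ε hf hc' hε
  rw [Set.mem_Ioi] at hε
  let m : Fin M ⊕ J → ℝ := Sum.elim mX w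
  let a : Fin M ⊕ J → ℝ := Sum.elim (fun k => Z k / (2 * ε)) fun _ => A
  have hm : ∀ i, 0 ≤ m i := by
    rintro (k | j)
    exacts [hmX k, hw j]
  have hm1 : ∑ i, m i = 1 := by
    rw [Fintype.sum_sum_type]
    simp only [m, Sum.elim_inl, Sum.elim_inr, hw1]
    ring
  have ha : ∀ i, 0 < a i := by
    rintro (k | j)
    · exact div_pos (hZ k) (by positivity)
    · exact hA0
  refine (iInf₂_le (mixtureProb hθ hm hm1 ha (Sum.elim X y)) (hS _ fun f hfS => ?_)).trans
    ((energy_mixtureProb_le hZ hθ hm hm1 ha y hε).trans (EReal.coe_le_coe_iff.2 ?_))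
  · rw [integral_mixtureProb, Fintype.sum_sum_type, hsplit f]
    simp only [m, a, Sum.elim_inl, Sum.elim_inr]
    have h1 := abs_lt.1 (hf f hfS)
    have h2 := abs_lt.1 (hAf f hfS)
    have h3 := abs_lt.1 (hwf f hfS)
    rw [abs_lt]
    constructor <;> linarith [h1.1, h1.2, h2.1, h2.2, h3.1, h3.2]
  · rw [Fintype.sum_sum_type]
    simp only [m, a, Sum.elim_inl, Sum.elim_inr]
    refine le_of_eq_of_le ?_ hc'.le
    rw [mul_add, add_sub_right_comm, Finset.mul_sum, Finset.mul_sum, ← Finset.sum_sub_distrib]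
    congr 1
    refine Finset.sum_congr rfl fun k _ => ?_
    field_simp
    ring

theorem gammaLiminf_le_gammaLimsup {ι α : Type*} [TopologicalSpace α] (l : Filter ι) [l.NeBot]
    (F : ι → α → EReal) (x : α) : gammaLiminf l F x ≤ gammaLimsup l F x :=
  iSup₂_mono fun _ _ => liminf_le_limsup

end DensityFunctional

end

theorem mainTheorem5 (M : ℕ) (Z : Fin M → ℝ) (hZ : ∀ k, 0 < Z k)
    (X : Fin M → DensityFunctional.R3) (hX : Function.Injective X) :
    DensityFunctional.GammaConverges (𝓝[>] (0 : ℝ)) (DensityFunctional.energy Z X)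
      (DensityFunctional.limitEnergy Z X) := by
  intro ρ
  have h1 := DensityFunctional.limitEnergy_le_gammaLiminf hZ hX ρ
  have h2 := DensityFunctional.gammaLimsup_le_limitEnergy hZ hX ρ
  have h3 := DensityFunctional.gammaLiminf_le_gammaLimsup (𝓝[>] (0 : ℝ))
    (DensityFunctional.energy Z X) ρ
  exact ⟨(h3.trans h2).antisymm h1, h2.antisymm (h1.trans h3)⟩
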